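/- Let $L^2(\mathbb R)$ be the Hilbert space of complex-valued square-integrable functions on $\mathbb R$, let $\mathcal B_1$ be the Banach space of trace-class operators on $L^2(\mathbb R)$ with the trace norm $\|A\|_1=\operatorname{tr}|A|$, $|A|=\sqrt{A^\dagger A}$, and let $\mathcal D\subset\mathcal B_1$ be the set of density matrices, i.e. self-adjoint, positive trace-class operators $\rho$ with $\operatorname{tr}\rho=1$. For $\rho\in\mathcal D$ with Hilbert--Schmidt kernel $K_\rho\in L^2(\mathbb R^2)$, the Wigner function $W\rho:\mathbb R^2\to\mathbb R$ is the continuous function given by $$W\rho(x,\xi)=\frac1{2\pi}\int_{\mathbb R}e^{-i\xi y}\,K_\rho\Bigl(x+\frac y2,\,x-\frac y2\Bigr)\,dy$$ for almost every $x\in\mathbb R$ and every $\xi\in\mathbb R$. Let $$\mathcal D_+=\{\rho\in\mathcal D:\ W\rho(z)\ge 0\ \text{for all } z\in\mathbb R^2\},\qquad \mathcal D_{0+}=\{\rho\in\mathcal D_+:\ W\rho(z)=0\ \text{for some } z\in\mathbb R^2\}.$$ Then $$\mathcal D_+=\overline{\mathcal D_{0+}},$$ where the closure is taken in $\mathcal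 B_1$ with respect to the trace norm. -/

import Mathlib

open MeasureTheory

namespace WignerPositive

noncomputable section

section TraceClass

variable {H : Type*} [NormedAddCommGroup H] [InnerProductSpace ℂ H] [CompleteSpace H]

/-- The index set of a fixed orthonormal basis of the Hilbert space `H`. -/
def basisIndex (H : Type*) [NormedAddCommGroup H] [InnerProductSpace ℂ H] [CompleteSpace H] :
    Set H :=
  (exists_hilbertBasis ℂ H).choose

/-- A fixed orthonormal (Hilbert) basis of `H`. The traces below do not depend on it. -/
def onb (H : Type*) [NormedAddCommGroup H] [InnerProductSpace ℂ H] [CompleteSpace H] :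
    HilbertBasis (basisIndex H) ℂ H :=
  (exists_hilbertBasis ℂ H).choose_spec.choose

/-- The trace norm `‖A‖₁ = tr |A|`, where `|A| = √(A† A)`, as an extended nonnegative number. -/
def traceNorm (A : H →L[ℂ] H) : ENNReal :=
  ∑' i, ENNReal.ofReal (inner ℂ (onb H i) (CFC.abs A (onb H i))).re

/-- The space `𝓑₁(H)` of trace-class operators: bounded operators of finite trace norm. -/
def traceClass (H : Type*) [NormedAddCommGroup H] [InnerProductSpace ℂ H] [CompleteSpace H] :
    Set (H →L[ℂ] H) :=
  {A | traceNorm A < ⊤}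

/-- The trace `tr A = ∑ ⟨φₙ, A φₙ⟩`, used only for trace-class `A`, where the series converges
absolutely. -/
def trace (A : H →L[ℂ] H) : ℂ :=
  ∑' i, inner ℂ (onb H i) (A (onb H i))

/-- The closure in `𝓑₁(H)`, with respect to the trace norm, of a set of operators. -/
def traceClosure (S : Set (H →L[ℂ] H)) : Set (H →L[ℂ] H) :=
  {A | A ∈ traceClass H ∧ ∀ ε : ENNReal, 0 < ε → ∃ B ∈ S, traceNorm (A - B) < ε}

/-- The density matrices `𝓓(H)`: self-adjoint positive trace-class operators of unit trace. -/
def densityMatrices (H : Type*) [NormedAddCommGroup H] [InnerProductSpace ℂ H] [CompleteSpace H] :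
    Set (H →L[ℂ] H) :=
  {ρ | ρ ∈ traceClass H ∧ IsSelfAdjoint ρ ∧ trace ρ = 1 ∧ ρ.IsPositive}

end TraceClass

/-- The Hilbert space `L²(ℝ)` of complex-valued square-integrable functions. -/
abbrev L2R : Type := Lp ℂ 2 (volume : Measure ℝ)

/-- `K ∈ L²(ℝ²)` is the Hilbert–Schmidt kernel of `ρ`: for every `ψ ∈ L²(ℝ)`,
`(ρ ψ)(x) = ∫ K(x, y) ψ(y) dy` for almost every `x`. -/
def IsHilbertSchmidtKernel (ρ : L2R →L[ℂ] L2R) (K : ℝ × ℝ → ℂ) : Prop :=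
  MemLp K 2 (volume : Measure (ℝ × ℝ)) ∧
    ∀ ψ : L2R, ∀ᵐ x : ℝ, ρ ψ x = ∫ y : ℝ, K (x, y) * ψ y

/-- `W` is the Wigner function of `ρ`, i.e. the continuous function on phase space with
`W(x, ξ) = (2π)⁻¹ ∫ exp(-i ξ y) K(x + y/2, x - y/2) dy`, where `K` is the Hilbert–Schmidt kernel
of `ρ`. As `K` is determined only up to a null set, the formula is required for almost every `x`
(and every `ξ`); by continuity this determines `W` at every point. -/
def IsWignerFunction (ρ : L2R →L[ℂ] L2R) (W : ℝ × ℝ → ℝ) : Prop :=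
  Continuous W ∧
    ∃ K : ℝ × ℝ → ℂ, IsHilbertSchmidtKernel ρ K ∧
      ∀ᵐ x : ℝ, Integrable (fun y : ℝ => K (x + y / 2, x - y / 2)) ∧
        ∀ ξ : ℝ, (W (x, ξ) : ℂ) =
          1 / (2 * (Real.pi : ℂ)) *
            ∫ y : ℝ, Complex.exp (-(Complex.I * (ξ : ℂ) * (y : ℂ))) * K (x + y / 2, x - y / 2)

/-- The nodal set of a function on phase space. -/
def nodalSet (W : ℝ × ℝ → ℝ) : Set (ℝ × ℝ) :=
  {z | W z = 0}

/-- The set `𝓓₊` of Wigner-positive states: the (unique) Wigner function of the density matrix `ρ`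
is nonnegative at every point. -/
def wignerPositiveStates : Set (L2R →L[ℂ] L2R) :=
  {ρ | ρ ∈ densityMatrices L2R ∧ ∃ W, IsWignerFunction ρ W ∧ ∀ z, 0 ≤ W z}

/-- The set `𝓓₀₊` of Wigner-positive states whose Wigner function has a zero. -/
def vanishingWignerPositiveStates : Set (L2R →L[ℂ] L2R) :=
  {ρ | ρ ∈ wignerPositiveStates ∧ ∃ W, IsWignerFunction ρ W ∧ (nodalSet W).Nonempty}

end

end WignerPositive

/-!
Write `‖·‖₁` for the trace norm.

*Closedness.* Wigner functions depend continuously on the operator: if `A - B` is self-adjoint, then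
`|W_A - W_B| ≤ 2 ‖A - B‖₁` everywhere (`IsWignerFunction.enorm_sub_le`). Split `A - B = P - N` with
`P` and `N` positive of trace norm at most `‖A - B‖₁`; Wigner functions are linear and unique, so
`A + N = B + P` gives `W_A - W_B = W_P - W_N`, and a positive trace-class operator has a Wigner
function bounded by its trace (`exists_isWignerFunction`). The latter follows from the expansion
`P = ∑ |fₙ⟩⟨fₙ|`, `fₙ = √P φₙ`, `∑ ‖fₙ‖² = tr P`, which makes the series of Wigner transforms of the
`fₙ` converge uniformly. Density matrices are closed because the trace norm dominates both the
operator norm and the variation of the trace. Hence the Wigner-positive states are closed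
(`wignerPositiveStates_closed`).

*Density.* Let `ρ` have a strictly positive Wigner function `W`. By the Riemann–Lebesgue lemma `W`
is small at some point `z₀` of phase space. The first excited state of the harmonic oscillator,
moved to `z₀`, has the Wigner function `V(z) = π⁻¹ (2|z - z₀|² - 1) exp(-|z - z₀|²)`, which is
negative only in a bounded disc and equals `-1/π` at `z₀`. Let `1 / s` be the maximum of `-V / W`
near `z₀`. Then `W + s V` is nonnegative and has a zero, and `s ≤ π W(z₀)` is small
(`exists_add_mul_excitedWigner`). The normalized mixture of `ρ` and the projection onto the excited
state therefore lies in the vanishing class, and it is close to `ρ`, because a difference of density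
matrices has trace norm at most `2` (`traceNorm_sub_le`).
-/

namespace WignerPositive

noncomputable section

/-! ### Hilbert–Schmidt and trace norms of positive operators -/

section Operators

variable {H : Type*} [NormedAddCommGroup H] [InnerProductSpace ℂ H]

theorem two_mul_enorm_inner_le (x y : H) : 2 * ‖inner ℂ x y‖ₑ ≤ ‖x‖ₑ ^ 2 + ‖y‖ₑ ^ 2 := by
  have h : 2 * ‖inner ℂ x y‖ ≤ ‖x‖ ^ 2 + ‖y‖ ^ 2 := by
    nlinarith [norm_inner_le_norm (𝕜 := ℂ) x y, sq_nonneg (‖x‖ - ‖y‖)]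
  have := ENNReal.ofReal_le_ofReal h
  rwa [ENNReal.ofReal_add (by positivity) (by positivity), ENNReal.ofReal_mul (by norm_num),
    ENNReal.ofReal_pow (norm_nonneg _), ENNReal.ofReal_pow (norm_nonneg _), ofReal_norm,
    ofReal_norm, ofReal_norm, ENNReal.ofReal_ofNat] at this

theorem re_inner_apply_nonneg {P : H →L[ℂ] H} (hP : 0 ≤ P) (x : H) :
    0 ≤ (inner ℂ x (P x)).re :=
  ((ContinuousLinearMap.nonneg_iff_isPositive P).1 hP).re_inner_nonneg_right x

variable [CompleteSpace H]

/-- The square `∑ ‖S φₙ‖²` of the Hilbert–Schmidt norm of `S`, possibly infinite. -/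
def hilbertSchmidtSq (S : H →L[ℂ] H) : ENNReal :=
  ∑' i, ‖S (onb H i)‖ₑ ^ 2

theorem enorm_sq_eq_tsum (x : H) : ‖x‖ₑ ^ 2 = ∑' i, ‖inner ℂ (onb H i) x‖ₑ ^ 2 := by
  have h := (onb H).hasSum_inner_mul_inner x x
  have h2 : HasSum (fun i => ‖inner ℂ (onb H i) x‖ ^ 2) (‖x‖ ^ 2) := by
    have := Complex.hasSum_re h
    convert this using 1
    · ext i
      rw [← inner_conj_symm x, ← Complex.normSq_eq_conj_mul_self, Complex.normSq_eq_norm_sq]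
      norm_cast
    · exact (inner_self_eq_norm_sq (𝕜 := ℂ) x).symm
  have h3 := h2.tsum_eq
  rw [← ofReal_norm, ← ENNReal.ofReal_pow (norm_nonneg _), ← h3,
    ENNReal.ofReal_tsum_of_nonneg (fun _ => by positivity) h2.summable]
  congr 1; ext i
  rw [← ofReal_norm, ← ENNReal.ofReal_pow (norm_nonneg _)]

theorem hilbertSchmidtSq_star (S : H →L[ℂ] H) : hilbertSchmidtSq (star S) = hilbertSchmidtSq S := by
  unfold hilbertSchmidtSq
  simp_rw [enorm_sq_eq_tsum (S _), enorm_sq_eq_tsum ((star S) _)]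
  rw [ENNReal.tsum_comm]
  congr 1; ext i; congr 1; ext j
  rw [ContinuousLinearMap.star_eq_adjoint, ContinuousLinearMap.adjoint_inner_right,
    ← inner_conj_symm, RCLike.enorm_conj]

theorem enorm_apply_sq_le (S : H →L[ℂ] H) (x : H) :
    ‖S x‖ₑ ^ 2 ≤ hilbertSchmidtSq S * ‖x‖ₑ ^ 2 := by
  rw [← hilbertSchmidtSq_star, hilbertSchmidtSq, enorm_sq_eq_tsum, ← ENNReal.tsum_mul_right]
  refine ENNReal.tsum_le_tsum fun i => ?_
  rw [← mul_pow, ← ContinuousLinearMap.adjoint_inner_left]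
  gcongr
  rw [← ofReal_norm, ← ofReal_norm, ← ofReal_norm, ← ENNReal.ofReal_mul (norm_nonneg _)]
  exact ENNReal.ofReal_le_ofReal (norm_inner_le_norm _ _)

theorem hilbertSchmidtSq_mul_le (S U : H →L[ℂ] H) (hU : ‖U‖ ≤ 1) :
    hilbertSchmidtSq (S * U) ≤ hilbertSchmidtSq S := by
  rw [← hilbertSchmidtSq_star, ← hilbertSchmidtSq_star S, star_mul]
  refine ENNReal.tsum_le_tsum fun i => ?_
  gcongr
  rw [mul_apply_eq_comp, enorm_le_iff_norm_le]
  refine (ContinuousLinearMap.le_opNorm _ _).trans (mul_le_of_le_one_left (norm_nonneg _) ?_)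
  rwa [norm_star]

theorem inner_apply_eq_inner_sqrt {P : H →L[ℂ] H} (hP : 0 ≤ P) (x y : H) :
    inner ℂ x (P y) = inner ℂ (CFC.sqrt P x) (CFC.sqrt P y) := by
  have h1 : IsSelfAdjoint (CFC.sqrt P) := (CFC.sqrt_nonneg P).isSelfAdjoint
  conv_lhs => rw [← CFC.sqrt_mul_sqrt_self P]
  rw [mul_apply_eq_comp, ← ContinuousLinearMap.adjoint_inner_left,
    ← ContinuousLinearMap.star_eq_adjoint, h1.star_eq]

theorem ofReal_re_inner_apply {P : H →L[ℂ] H} (hP : 0 ≤ P) (x : H) :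
    ENNReal.ofReal (inner ℂ x (P x)).re = ‖CFC.sqrt P x‖ₑ ^ 2 := by
  rw [inner_apply_eq_inner_sqrt hP, ← ofReal_norm, ← ENNReal.ofReal_pow (norm_nonneg _)]
  congr 1
  exact inner_self_eq_norm_sq (𝕜 := ℂ) _

theorem traceNorm_of_nonneg {P : H →L[ℂ] H} (hP : 0 ≤ P) :
    traceNorm P = hilbertSchmidtSq (CFC.sqrt P) := by
  unfold traceNorm hilbertSchmidtSq
  rw [CFC.abs_of_nonneg P]
  simp_rw [ofReal_re_inner_apply hP]

theorem traceNorm_abs (T : H →L[ℂ] H) : traceNorm (CFC.abs T) = traceNorm T := by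
  unfold traceNorm
  rw [CFC.cfcAbs_cfcAbs]

/-- On positive operators the trace norm is monotone. -/
theorem traceNorm_mono {P Q : H →L[ℂ] H} (hP : 0 ≤ P) (hPQ : P ≤ Q) :
    traceNorm P ≤ traceNorm Q := by
  unfold traceNorm
  rw [CFC.abs_of_nonneg P, CFC.abs_of_nonneg Q (hP.trans hPQ)]
  refine ENNReal.tsum_le_tsum fun i => ENNReal.ofReal_le_ofReal ?_
  have := re_inner_apply_nonneg (sub_nonneg.2 hPQ) (onb H i)
  simp only [sub_apply, inner_sub_right, Complex.sub_re] at this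
  linarith

theorem traceNorm_add_of_nonneg {P Q : H →L[ℂ] H} (hP : 0 ≤ P) (hQ : 0 ≤ Q) :
    traceNorm (P + Q) = traceNorm P + traceNorm Q := by
  unfold traceNorm
  rw [CFC.abs_of_nonneg P, CFC.abs_of_nonneg Q, CFC.abs_of_nonneg (P + Q) (add_nonneg hP hQ),
    ← ENNReal.tsum_add]
  congr 1; ext i
  rw [← ENNReal.ofReal_add (re_inner_apply_nonneg hP _) (re_inner_apply_nonneg hQ _)]
  simp

theorem traceNorm_zero : traceNorm (0 : H →L[ℂ] H) = 0 := by
  simp [traceNorm]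

theorem traceNorm_smul (c : ℝ) (T : H →L[ℂ] H) :
    traceNorm ((c : ℂ) • T) = ENNReal.ofReal |c| * traceNorm T := by
  unfold traceNorm
  rw [CFC.abs_smul, ← ENNReal.tsum_mul_left]
  congr 1; ext i
  rw [← ENNReal.ofReal_mul (abs_nonneg _)]
  simp [Complex.real_smul]

theorem traceNorm_posPart_le {T : H →L[ℂ] H} (hT : IsSelfAdjoint T) :
    traceNorm T⁺ ≤ traceNorm T := by
  rw [← traceNorm_abs T]
  refine traceNorm_mono (CFC.posPart_nonneg T) ?_
  rw [← CFC.posPart_add_negPart T]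
  exact le_add_of_nonneg_right (CFC.negPart_nonneg T)

theorem traceNorm_negPart_le {T : H →L[ℂ] H} (hT : IsSelfAdjoint T) :
    traceNorm T⁻ ≤ traceNorm T := by
  rw [← traceNorm_abs T]
  refine traceNorm_mono (CFC.negPart_nonneg T) ?_
  rw [← CFC.posPart_add_negPart T]
  exact le_add_of_nonneg_left (CFC.posPart_nonneg T)

/-- The trace norm dominates the operator norm. -/
theorem enorm_le_traceNorm (T : H →L[ℂ] H) : ‖T‖ₑ ≤ traceNorm T := by
  have h0 : 0 ≤ CFC.abs T := CFC.abs_nonneg T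
  rw [← traceNorm_abs, traceNorm_of_nonneg h0]
  have hS : IsSelfAdjoint (CFC.sqrt (CFC.abs T)) := (CFC.sqrt_nonneg _).isSelfAdjoint
  set S := CFC.sqrt (CFC.abs T) with hSdef
  by_cases htop : hilbertSchmidtSq S = ⊤
  · simp [htop]
  have h1 : ‖T‖ ≤ (hilbertSchmidtSq S).toReal := by
    rw [← CFC.norm_abs]
    refine ContinuousLinearMap.opNorm_le_bound _ ENNReal.toReal_nonneg fun x => ?_
    have h3 : ‖S (S x)‖ₑ ^ 2 ≤ (hilbertSchmidtSq S * ‖x‖ₑ) ^ 2 := by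
      calc ‖S (S x)‖ₑ ^ 2 ≤ hilbertSchmidtSq S * (hilbertSchmidtSq S * ‖x‖ₑ ^ 2) :=
            (enorm_apply_sq_le S _).trans (by gcongr; exact enorm_apply_sq_le S x)
        _ = _ := by ring
    have h4 := (ENNReal.pow_le_pow_left_iff two_ne_zero).1 h3
    rw [← CFC.sqrt_mul_sqrt_self (CFC.abs T), mul_apply_eq_comp]
    have := ENNReal.toReal_mono (ENNReal.mul_ne_top htop enorm_ne_top) h4
    simpa using this
  rw [← ofReal_norm]
  exact ENNReal.ofReal_le_of_le_toReal h1

/-- Half of the duality between bounded and trace-class operators: `∑ |⟨φₙ, P U φₙ⟩| ≤ tr P` for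
positive `P` and contractions `U`, by writing `P U = √P (√P U)`. -/
theorem tsum_enorm_inner_mul_le {P U : H →L[ℂ] H} (hP : 0 ≤ P) (hU : ‖U‖ ≤ 1) :
    ∑' i, ‖inner ℂ (onb H i) (P (U (onb H i)))‖ₑ ≤ traceNorm P := by
  rw [traceNorm_of_nonneg hP]
  have h : 2 * ∑' i, ‖inner ℂ (onb H i) (P (U (onb H i)))‖ₑ ≤
      2 * hilbertSchmidtSq (CFC.sqrt P) := by
    rw [← ENNReal.tsum_mul_left, two_mul (hilbertSchmidtSq _)]
    calc _ ≤ ∑' i, (‖CFC.sqrt P (onb H i)‖ₑ ^ 2 + ‖CFC.sqrt P (U (onb H i))‖ₑ ^ 2) := by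
          refine ENNReal.tsum_le_tsum fun i => ?_
          rw [inner_apply_eq_inner_sqrt hP]
          exact two_mul_enorm_inner_le _ _
      _ = hilbertSchmidtSq (CFC.sqrt P) + hilbertSchmidtSq (CFC.sqrt P * U) := ENNReal.tsum_add
      _ ≤ _ := by gcongr; exact hilbertSchmidtSq_mul_le _ _ hU
  exact (ENNReal.mul_le_mul_iff_right two_ne_zero ENNReal.ofNat_ne_top).1 h

/-- The pointwise bound `|t| ≤ t · t / (|t| + δ) + δ`, transported by the functional calculus. -/
theorem abs_le_mul_cfc_add {T : H →L[ℂ] H} (hT : IsSelfAdjoint T) {δ : ℝ} (hδ : 0 < δ) :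
    CFC.abs T ≤ T * cfc (fun t : ℝ => t / (|t| + δ)) T + (δ : ℂ) • (1 : H →L[ℂ] H) := by
  have hc : Continuous fun t : ℝ => t / (|t| + δ) :=
    continuous_id.div (by fun_prop) fun t => by positivity
  have hc' : Continuous fun t : ℝ => t * (t / (|t| + δ)) := continuous_id.mul hc
  have h1 : T * cfc (fun t : ℝ => t / (|t| + δ)) T + (δ : ℂ) • (1 : H →L[ℂ] H) =
      cfc (fun t : ℝ => t * (t / (|t| + δ)) + δ) T := by
    rw [cfc_add_const δ _ T hc'.continuousOn, cfc_mul _ _ T (by fun_prop) hc.continuousOn,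
      cfc_id' ℝ T, Algebra.algebraMap_eq_smul_one]
    rfl
  rw [h1, CFC.abs_eq_cfc_norm T]
  refine cfc_mono (fun t _ => ?_) (by fun_prop)
    (hc'.add continuous_const).continuousOn
  rw [Real.norm_eq_abs, mul_div_assoc', ← sq, ← sq_abs, ← sub_le_iff_le_add,
    le_div_iff₀ (by positivity)]
  nlinarith

theorem norm_cfc_div_abs_add_le (T : H →L[ℂ] H) {δ : ℝ} (hδ : 0 < δ) :
    ‖cfc (fun t : ℝ => t / (|t| + δ)) T‖ ≤ 1 := by
  refine norm_cfc_le zero_le_one fun t _ => ?_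
  rw [norm_div, Real.norm_eq_abs, Real.norm_of_nonneg (by positivity)]
  exact (div_le_one (by positivity)).2 (by linarith)

/-- The trace norm of a difference of positive operators, bounded by testing `|T|` against the
regularized sign `T / (|T| + δ)` of `T = P - Q` and letting `δ → 0`. -/
theorem traceNorm_sub_le {P Q : H →L[ℂ] H} (hP : 0 ≤ P) (hQ : 0 ≤ Q) :
    traceNorm (P - Q) ≤ traceNorm P + traceNorm Q := by
  have hT : IsSelfAdjoint (P - Q) := hP.isSelfAdjoint.sub hQ.isSelfAdjoint
  by_cases htop : traceNorm P + traceNorm Q = ⊤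
  · simp [htop]
  refine ENNReal.summable.tsum_le_of_sum_le fun F => ?_
  refine ENNReal.le_of_forall_pos_le_add fun ε hε _ => ?_
  set δ : ℝ := ε / (F.card + 1) with hδdef
  have hδ : 0 < δ := by positivity
  set U := cfc (fun t : ℝ => t / (|t| + δ)) (P - Q) with hU
  have hU1 : ‖U‖ ≤ 1 := norm_cfc_div_abs_add_le _ hδ
  have key (i) : ENNReal.ofReal (inner ℂ (onb H i) (CFC.abs (P - Q) (onb H i))).re ≤
      ‖inner ℂ (onb H i) (P (U (onb H i)))‖ₑ + ‖inner ℂ (onb H i) (Q (U (onb H i)))‖ₑ +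
        ENNReal.ofReal δ := by
    have h := re_inner_apply_nonneg (sub_nonneg.2 (abs_le_mul_cfc_add hT hδ)) (onb H i)
    have hn : inner ℂ (onb H i) (onb H i) = 1 := by
      rw [inner_self_eq_norm_sq_to_K, (onb H).orthonormal.1 i]; simp
    simp only [sub_apply, add_apply, mul_apply_eq_comp, ← hU, inner_sub_right, inner_add_right,
      smul_apply, inner_smul_right, one_apply_eq_self, hn] at h
    rw [← ofReal_norm, ← ofReal_norm, ← ENNReal.ofReal_add (by positivity) (by positivity),
      ← ENNReal.ofReal_add (by positivity) (by positivity)]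
    refine ENNReal.ofReal_le_ofReal ?_
    have h1 := Complex.re_le_norm (inner ℂ (onb H i) (P (U (onb H i))))
    have h2 := (abs_le.1 (Complex.abs_re_le_norm (inner ℂ (onb H i) (Q (U (onb H i)))))).1
    simp at h
    linarith
  calc _ ≤ ∑ i ∈ F, (‖inner ℂ (onb H i) (P (U (onb H i)))‖ₑ +
        ‖inner ℂ (onb H i) (Q (U (onb H i)))‖ₑ + ENNReal.ofReal δ) :=
        Finset.sum_le_sum fun i _ => key i
    _ = ∑ i ∈ F, ‖inner ℂ (onb H i) (P (U (onb H i)))‖ₑ +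
        ∑ i ∈ F, ‖inner ℂ (onb H i) (Q (U (onb H i)))‖ₑ + F.card * ENNReal.ofReal δ := by
        rw [Finset.sum_add_distrib, Finset.sum_add_distrib, Finset.sum_const, nsmul_eq_mul]
    _ ≤ traceNorm P + traceNorm Q + ε := by
        gcongr
        · exact (ENNReal.sum_le_tsum F).trans (tsum_enorm_inner_mul_le hP hU1)
        · exact (ENNReal.sum_le_tsum F).trans (tsum_enorm_inner_mul_le hQ hU1)
        · rw [← ENNReal.ofReal_natCast, ← ENNReal.ofReal_mul (by positivity),
            ← ENNReal.ofReal_coe_nnreal]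
          refine ENNReal.ofReal_le_ofReal ?_
          rw [hδdef, mul_div_assoc', div_le_iff₀ (by positivity)]
          nlinarith [ε.coe_nonneg]

theorem inner_apply_eq_ofReal_re {P : H →L[ℂ] H} (hP : 0 ≤ P) (x : H) :
    inner ℂ x (P x) = ((inner ℂ x (P x)).re : ℂ) := by
  rw [inner_apply_eq_inner_sqrt hP, inner_self_eq_norm_sq_to_K]
  norm_cast

theorem enorm_inner_apply {P : H →L[ℂ] H} (hP : 0 ≤ P) (x : H) :
    ‖inner ℂ x (P x)‖ₑ = ENNReal.ofReal (inner ℂ x (P x)).re := by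
  conv_lhs => rw [inner_apply_eq_ofReal_re hP, ← ofReal_norm, Complex.norm_real,
    Real.norm_of_nonneg (re_inner_apply_nonneg hP x)]

theorem traceNorm_eq_tsum_enorm {P : H →L[ℂ] H} (hP : 0 ≤ P) :
    traceNorm P = ∑' i, ‖inner ℂ (onb H i) (P (onb H i))‖ₑ := by
  simp_rw [enorm_inner_apply hP, traceNorm, CFC.abs_of_nonneg P]

theorem summable_inner_apply {P : H →L[ℂ] H} (hP : 0 ≤ P) (h : traceNorm P ≠ ⊤) :
    Summable fun i => inner ℂ (onb H i) (P (onb H i)) :=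
  Summable.of_enorm (by rwa [← traceNorm_eq_tsum_enorm hP])

theorem trace_eq_toReal_traceNorm {P : H →L[ℂ] H} (hP : 0 ≤ P) :
    trace P = ((traceNorm P).toReal : ℂ) := by
  rw [traceNorm_eq_tsum_enorm hP, ENNReal.tsum_toReal_eq fun _ => enorm_ne_top, Complex.ofReal_tsum,
    trace]
  congr 1; ext i
  rw [enorm_inner_apply hP, ENNReal.toReal_ofReal (re_inner_apply_nonneg hP _)]
  exact inner_apply_eq_ofReal_re hP _

theorem enorm_inner_apply_le_abs {T : H →L[ℂ] H} (hT : IsSelfAdjoint T) (x : H) :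
    ‖inner ℂ x (T x)‖ₑ ≤ ENNReal.ofReal (inner ℂ x (CFC.abs T x)).re := by
  have h1 : T x = T⁺ x - T⁻ x := by rw [← sub_apply, CFC.posPart_sub_negPart T]
  have h2 : CFC.abs T x = T⁺ x + T⁻ x := by rw [← add_apply, CFC.posPart_add_negPart T]
  have hp : 0 ≤ T⁺ := CFC.posPart_nonneg T
  have hn : 0 ≤ T⁻ := CFC.negPart_nonneg T
  rw [h1, h2, inner_add_right, inner_sub_right, Complex.add_re,
    ENNReal.ofReal_add (re_inner_apply_nonneg hp x) (re_inner_apply_nonneg hn x),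
    ← enorm_inner_apply hp x, ← enorm_inner_apply hn x]
  exact enorm_sub_le

theorem enorm_trace_sub_le {P Q : H →L[ℂ] H} (hP : 0 ≤ P) (hQ : 0 ≤ Q) (h : traceNorm P ≠ ⊤)
    (h' : traceNorm Q ≠ ⊤) : ‖trace P - trace Q‖ₑ ≤ traceNorm (P - Q) := by
  have hT : IsSelfAdjoint (P - Q) := hP.isSelfAdjoint.sub hQ.isSelfAdjoint
  unfold trace
  rw [← (summable_inner_apply hP h).tsum_sub (summable_inner_apply hQ h')]
  refine enorm_tsum_le_tsum_enorm.trans (ENNReal.tsum_le_tsum fun i => ?_)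
  rw [← inner_sub_right, ← sub_apply]
  exact enorm_inner_apply_le_abs hT _

/-- The Jordan decomposition of a self-adjoint operator, in trace norm. -/
theorem exists_nonneg_sub_nonneg {T : H →L[ℂ] H} (hT : IsSelfAdjoint T) :
    ∃ P N : H →L[ℂ] H, 0 ≤ P ∧ 0 ≤ N ∧ P - N = T ∧
      traceNorm P ≤ traceNorm T ∧ traceNorm N ≤ traceNorm T :=
  ⟨T⁺, T⁻, CFC.posPart_nonneg T, CFC.negPart_nonneg T, CFC.posPart_sub_negPart T,
    traceNorm_posPart_le hT, traceNorm_negPart_le hT⟩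

end Operators

/-! ### Cross-Wigner integrals of square-integrable functions -/

section Functions

theorem eLpNorm_two_eq {α : Type*} [MeasurableSpace α] {μ : Measure α} (f : α → ℂ) :
    eLpNorm f 2 μ = (∫⁻ u, ‖f u‖ₑ ^ 2 ∂μ) ^ (1 / 2 : ℝ) := by
  rw [eLpNorm_eq_lintegral_rpow_enorm_toReal two_ne_zero ENNReal.ofNat_ne_top]
  simp

theorem lintegral_comp_affine {h : ℝ → ENNReal} (hh : Measurable h) (x : ℝ) {a : ℝ}
    (ha : |a| = 1 / 2) :
    ∫⁻ y, h (x + a * y) = 2 * ∫⁻ u, h u := by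
  have ha0 : a ≠ 0 := by rintro rfl; norm_num at ha
  rw [← lintegral_add_left_eq_self h x]
  conv_rhs => rw [← Real.smul_map_volume_mul_left ha0, lintegral_smul_measure,
    lintegral_map (by fun_prop) (by fun_prop), ha, smul_eq_mul, ← mul_assoc,
    ← ENNReal.ofReal_ofNat, ← ENNReal.ofReal_mul (by norm_num)]
  norm_num

/-- Cauchy–Schwarz for the integrand of a cross-Wigner function. -/
theorem lintegral_enorm_mul_le {f g : ℝ → ℂ} (hf : Measurable f) (hg : Measurable g) (x : ℝ) :
    ∫⁻ y, ‖f (x + y / 2)‖ₑ * ‖g (x - y / 2)‖ₑ ≤ 2 * (eLpNorm f 2 volume * eLpNorm g 2 volume) := by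
  have h := ENNReal.lintegral_mul_le_Lp_mul_Lq volume Real.HolderConjugate.two_two
    (f := fun y => ‖f (x + 1 / 2 * y)‖ₑ) (g := fun y => ‖g (x + (-(1 / 2)) * y)‖ₑ)
    (by fun_prop) (by fun_prop)
  simp only [ENNReal.rpow_ofNat] at h
  rw [lintegral_comp_affine (h := fun u => ‖f u‖ₑ ^ 2) (by fun_prop) x (by norm_num),
    lintegral_comp_affine (h := fun u => ‖g u‖ₑ ^ 2) (by fun_prop) x (by norm_num),
    ENNReal.mul_rpow_of_nonneg _ _ (by norm_num), ENNReal.mul_rpow_of_nonneg _ _ (by norm_num),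
    mul_mul_mul_comm, ← ENNReal.rpow_add _ _ two_ne_zero ENNReal.ofNat_ne_top,
    ← eLpNorm_two_eq, ← eLpNorm_two_eq] at h
  norm_num at h
  convert h using 5 <;> ring_nf

/-- The cross-Wigner integral `∫ exp(-iξy) f(x + y/2) conj (g (x - y/2)) dy`, without the factor
`1 / (2π)`. -/
def crossWigner (f g : ℝ → ℂ) (z : ℝ × ℝ) : ℂ :=
  ∫ y : ℝ, Complex.exp (-(Complex.I * (z.2 : ℂ) * (y : ℂ))) *
    (f (z.1 + y / 2) * (starRingEnd ℂ) (g (z.1 - y / 2)))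

theorem norm_cexp_neg_I_mul (a b : ℝ) :
    ‖Complex.exp (-(Complex.I * (a : ℂ) * (b : ℂ)))‖ = 1 := by
  rw [show -(Complex.I * (a : ℂ) * (b : ℂ)) = ((-(a * b) : ℝ) : ℂ) * Complex.I by push_cast; ring]
  exact Complex.norm_exp_ofReal_mul_I _

theorem enorm_cexp_neg_I_mul (a b : ℝ) :
    ‖Complex.exp (-(Complex.I * (a : ℂ) * (b : ℂ)))‖ₑ = 1 := by
  rw [← ofReal_norm, norm_cexp_neg_I_mul, ENNReal.ofReal_one]

theorem lintegral_enorm_crossWigner_le {f g : ℝ → ℂ} (hf : Measurable f) (hg : Measurable g)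
    (z : ℝ × ℝ) :
    ∫⁻ y : ℝ, ‖Complex.exp (-(Complex.I * (z.2 : ℂ) * (y : ℂ))) *
      (f (z.1 + y / 2) * (starRingEnd ℂ) (g (z.1 - y / 2)))‖ₑ ≤
        2 * (eLpNorm f 2 volume * eLpNorm g 2 volume) := by
  simp_rw [enorm_mul, enorm_cexp_neg_I_mul, one_mul, RCLike.enorm_conj]
  exact lintegral_enorm_mul_le hf hg z.1

theorem integrable_crossWigner {f g : ℝ → ℂ} (hf : Measurable f) (hg : Measurable g)
    (hf2 : MemLp f 2) (hg2 : MemLp g 2) (z : ℝ × ℝ) :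
    Integrable fun y : ℝ => Complex.exp (-(Complex.I * (z.2 : ℂ) * (y : ℂ))) *
      (f (z.1 + y / 2) * (starRingEnd ℂ) (g (z.1 - y / 2))) := by
  refine ⟨Measurable.aestronglyMeasurable (by fun_prop), ?_⟩
  refine (lintegral_enorm_crossWigner_le hf hg z).trans_lt ?_
  exact ENNReal.mul_lt_top ENNReal.ofNat_lt_top (ENNReal.mul_lt_top hf2.2 hg2.2)

theorem enorm_crossWigner_le {f g : ℝ → ℂ} (hf : Measurable f) (hg : Measurable g) (z : ℝ × ℝ) :
    ‖crossWigner f g z‖ₑ ≤ 2 * (eLpNorm f 2 volume * eLpNorm g 2 volume) :=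
  (enorm_integral_le_lintegral_enorm _).trans (lintegral_enorm_crossWigner_le hf hg z)

theorem conj_crossWigner (f g : ℝ → ℂ) (z : ℝ × ℝ) :
    (starRingEnd ℂ) (crossWigner f g z) = crossWigner g f z := by
  unfold crossWigner
  rw [← integral_conj, ← integral_neg_eq_self]
  congr 1; ext y
  simp only [map_mul, ← Complex.exp_conj]
  simp [neg_div, sub_eq_add_neg, mul_comm]

theorem continuous_crossWigner_of_hasCompactSupport {g : ℝ → ℂ} (hg : Continuous g)
    (hs : HasCompactSupport g) : Continuous (crossWigner g g) := by
  obtain ⟨C, hC⟩ := hg.bounded_above_of_compact_support hs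
  obtain ⟨R, hR⟩ := hs.isBounded.subset_closedBall 0
  have hz (t : ℝ) (ht : R < |t|) : g t = 0 := by
    by_contra h
    have := hR (subset_tsupport g h)
    rw [mem_closedBall_zero_iff, Real.norm_eq_abs] at this
    linarith
  have hC0 : 0 ≤ C := (norm_nonneg _).trans (hC 0)
  refine continuous_of_dominated (bound := (Set.Icc (-(2 * R)) (2 * R)).indicator fun _ => C * C)
    (fun z => by fun_prop) (fun z => Filter.Eventually.of_forall fun y => ?_) ?_
    (Filter.Eventually.of_forall fun y => by fun_prop)
  · rw [norm_mul, norm_cexp_neg_I_mul, one_mul, norm_mul, RCLike.norm_conj]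
    by_cases hy : y ∈ Set.Icc (-(2 * R)) (2 * R)
    · rw [Set.indicator_of_mem hy]
      gcongr <;> exact hC _
    · rw [Set.indicator_of_notMem hy]
      have : 2 * R < |y| := by
        rw [Set.mem_Icc, ← abs_le, not_le] at hy
        exact hy
      -- `y = (x + y/2) - (x - y/2)`, so one of the two arguments leaves the support
      rcases lt_or_ge R |z.1 + y / 2| with h | h
      · simp [hz _ h]
      · have h2 : R < |z.1 - y / 2| := by
          by_contra! h3
          have := abs_sub (z.1 + y / 2) (z.1 - y / 2)
          rw [show z.1 + y / 2 - (z.1 - y / 2) = y by ring] at this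
          linarith
        simp [hz _ h2]
  · exact (integrable_indicator_iff measurableSet_Icc).2 (integrableOn_const (by simp))

theorem crossWigner_sub_left {f f' g : ℝ → ℂ} (hf : Measurable f) (hf' : Measurable f')
    (hg : Measurable g) (hf2 : MemLp f 2) (hf2' : MemLp f' 2) (hg2 : MemLp g 2) (z : ℝ × ℝ) :
    crossWigner (f - f') g z = crossWigner f g z - crossWigner f' g z := by
  unfold crossWigner
  rw [← integral_sub (integrable_crossWigner hf hg hf2 hg2 z)
    (integrable_crossWigner hf' hg hf2' hg2 z)]
  congr 1; ext y
  simp only [Pi.sub_apply]; ring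

theorem crossWigner_sub_right {f f' g : ℝ → ℂ} (hf : Measurable f) (hf' : Measurable f')
    (hg : Measurable g) (hf2 : MemLp f 2) (hf2' : MemLp f' 2) (hg2 : MemLp g 2) (z : ℝ × ℝ) :
    crossWigner g (f - f') z = crossWigner g f z - crossWigner g f' z := by
  rw [← conj_crossWigner, crossWigner_sub_left hf hf' hg hf2 hf2' hg2, map_sub, conj_crossWigner,
    conj_crossWigner]

/-- The Wigner transform of a square-integrable function is continuous, as a uniform limit of
Wigner transforms of continuous compactly supported functions. -/
theorem continuous_crossWigner_self {f : ℝ → ℂ} (hf : Measurable f) (hf2 : MemLp f 2) :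
    Continuous (crossWigner f f) := by
  refine continuous_of_uniform_approx_of_continuous fun u hu => ?_
  obtain ⟨ε, hε, hεu⟩ := mem_uniformity_edist.1 hu
  set N := eLpNorm f 2 volume
  have hN : N ≠ ⊤ := hf2.2.ne
  obtain ⟨δ, hδ, hδ'⟩ : ∃ δ : ENNReal, 0 < δ ∧ 2 * (δ * N) + 2 * ((N + δ) * δ) < ε := by
    obtain ⟨n, hn, hnε⟩ := ENNReal.exists_nnreal_pos_mul_lt
      (a := 2 * N + 2 * (N + 1)) (b := ε) (by finiteness) hε.ne'
    refine ⟨min n 1, lt_min (by simpa using hn) one_pos, lt_of_le_of_lt ?_ hnε⟩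
    calc 2 * (min (n : ENNReal) 1 * N) + 2 * ((N + min (n : ENNReal) 1) * min (n : ENNReal) 1)
        ≤ 2 * (n * N) + 2 * ((N + 1) * n) := by
          gcongr
          · exact min_le_left _ _
          · exact min_le_right _ _
          · exact min_le_left _ _
      _ = _ := by ring
  obtain ⟨g, hgs, hfg, hgc, hg2⟩ :=
    hf2.exists_hasCompactSupport_eLpNorm_sub_le ENNReal.ofNat_ne_top hδ.ne'
  have hgm := hgc.measurable
  refine ⟨crossWigner g g, continuous_crossWigner_of_hasCompactSupport hgc hgs, fun z => hεu ?_⟩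
  have h1 : crossWigner f f z - crossWigner g g z =
      crossWigner (f - g) f z + crossWigner g (f - g) z := by
    rw [crossWigner_sub_left hf hgm hf hf2 hg2 hf2, crossWigner_sub_right hf hgm hgm hf2 hg2 hg2]
    ring
  have h2 : eLpNorm g 2 volume ≤ N + δ := by
    have := eLpNorm_sub_le hf2.1 (hf2.sub hg2).1 (p := 2) (by norm_num)
    rw [sub_sub_cancel] at this
    exact this.trans (by gcongr)
  rw [edist_eq_enorm_sub, h1]
  refine lt_of_le_of_lt ((enorm_add_le _ _).trans (add_le_add
    (enorm_crossWigner_le (hf.sub hgm) hf z) (enorm_crossWigner_le hgm (hf.sub hgm) z))) ?_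
  refine lt_of_le_of_lt ?_ hδ'
  gcongr

end Functions

/-! ### Rank-one expansion of a positive operator -/

section Expansion

instance countable_basisIndex {H : Type*} [NormedAddCommGroup H] [InnerProductSpace ℂ H]
    [CompleteSpace H] [TopologicalSpace.SeparableSpace H] : Countable (basisIndex H) := by
  have hd : (Set.univ : Set (basisIndex H)).PairwiseDisjoint
      fun i => Metric.ball (onb H i) (1 / 2) := by
    intro i _ j _ hij
    refine Metric.ball_disjoint_ball ?_
    have h1 : ‖onb H i - onb H j‖ ^ 2 = 2 := by
      rw [@norm_sub_sq ℂ, (onb H).orthonormal.1 i, (onb H).orthonormal.1 j,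
        (onb H).orthonormal.2 hij]
      norm_num
    rw [dist_eq_norm]
    nlinarith [norm_nonneg (onb H i - onb H j)]
  exact Set.countable_univ_iff.1 <| hd.countable_of_isOpen (fun _ _ => Metric.isOpen_ball)
    fun i _ => ⟨onb H i, Metric.mem_ball_self (by norm_num)⟩

/-- A positive operator is the strongly convergent sum of the rank-one operators `|fₙ⟩⟨fₙ|` with
`fₙ = √P φₙ`; no spectral decomposition is needed. -/
theorem hasSum_inner_sqrt_smul {H : Type*} [NormedAddCommGroup H] [InnerProductSpace ℂ H]
    [CompleteSpace H] {P : H →L[ℂ] H} (hP : 0 ≤ P) (x : H) :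
    HasSum (fun i => inner ℂ (CFC.sqrt P (onb H i)) x • CFC.sqrt P (onb H i)) (P x) := by
  have hS : IsSelfAdjoint (CFC.sqrt P) := (CFC.sqrt_nonneg P).isSelfAdjoint
  have h := ((onb H).hasSum_repr (CFC.sqrt P x)).mapL (CFC.sqrt P)
  rw [← mul_apply_eq_comp, CFC.sqrt_mul_sqrt_self P] at h
  convert! h using 1
  ext i
  rw [map_smul, HilbertBasis.repr_apply_apply, ← ContinuousLinearMap.adjoint_inner_left,
    ← ContinuousLinearMap.star_eq_adjoint, hS.star_eq]

end Expansion

/-! ### Kernel and Wigner function of a positive trace-class operator -/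

section Kernel

instance separableSpace_L2R : TopologicalSpace.SeparableSpace L2R :=
  haveI : Fact ((2 : ENNReal) ≠ ⊤) := ⟨ENNReal.ofNat_ne_top⟩
  inferInstance

variable {ι : Type*}

/-- An `Lᵖ`-normally convergent series is in `Lᵖ`, as a pointwise sum. -/
theorem memLp_tsum [Countable ι] {α : Type*} [MeasurableSpace α] {μ : Measure α} {p : ENNReal}
    [Fact (1 ≤ p)] {G : ι → α → ℂ} (hG : ∀ i, MemLp (G i) p μ) (hs : ∑' i, eLpNorm (G i) p μ ≠ ⊤) :
    MemLp (fun a => ∑' i, G i a) p μ := by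
  have h := Lp.coeFn_tsum (f := fun i => MemLp.toLp (G i) (hG i))
    (by simpa [Lp.enorm_toLp] using hs)
  have h2 : ∀ᵐ a ∂μ, ∀ i, MemLp.toLp (G i) (hG i) a = G i a :=
    ae_all_iff.2 fun i => (hG i).coeFn_toLp
  refine (memLp_congr_ae ?_).1 (Lp.memLp (∑' i, MemLp.toLp (G i) (hG i)))
  filter_upwards [h, h2] with a ha ha2
  simp [ha, ha2]

theorem eLpNorm_mul_conj {f g : ℝ → ℂ} (hf : Measurable f) (hg : Measurable g) :
    eLpNorm (fun p : ℝ × ℝ => f p.1 * (starRingEnd ℂ) (g p.2)) 2 volume =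
      eLpNorm f 2 volume * eLpNorm g 2 volume := by
  rw [eLpNorm_two_eq, eLpNorm_two_eq, eLpNorm_two_eq, Measure.volume_eq_prod]
  simp_rw [enorm_mul, RCLike.enorm_conj, mul_pow]
  rw [lintegral_prod_mul (f := fun x => ‖f x‖ₑ ^ 2) (g := fun x => ‖g x‖ₑ ^ 2) (by fun_prop)
    (by fun_prop), ENNReal.mul_rpow_of_nonneg _ _ (by norm_num)]

theorem memLp_mul_conj {f g : ℝ → ℂ} (hf : Measurable f) (hg : Measurable g) (hf2 : MemLp f 2)
    (hg2 : MemLp g 2) :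
    MemLp (fun p : ℝ × ℝ => f p.1 * (starRingEnd ℂ) (g p.2)) 2 volume := by
  refine ⟨Measurable.aestronglyMeasurable (by fun_prop), ?_⟩
  rw [eLpNorm_mul_conj hf hg]
  exact ENNReal.mul_lt_top hf2.2 hg2.2

theorem measurable_coeFn (f : L2R) : Measurable f := (Lp.stronglyMeasurable f).measurable

theorem inner_eq_integral (f g : L2R) : inner ℂ f g = ∫ y, (starRingEnd ℂ) (f y) * g y := by
  rw [L2.inner_def]
  congr 1; ext y
  simp [mul_comm]

theorem lintegral_enorm_conj_mul_le (f g : L2R) :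
    ∫⁻ y, ‖(starRingEnd ℂ) (f y) * g y‖ₑ ≤ ‖f‖ₑ * ‖g‖ₑ := by
  have hf := (measurable_coeFn f)
  have hg := (measurable_coeFn g)
  have h := ENNReal.lintegral_mul_le_Lp_mul_Lq volume Real.HolderConjugate.two_two
    (f := fun y => ‖f y‖ₑ) (g := fun y => ‖g y‖ₑ) (by fun_prop) (by fun_prop)
  simp only [ENNReal.rpow_ofNat] at h
  rw [← eLpNorm_two_eq, ← eLpNorm_two_eq, ← Lp.enorm_def, ← Lp.enorm_def] at h
  simpa [enorm_mul] using h

/-- The kernel `∑ fₙ(x) conj fₙ(y)` of the operator `∑ |fₙ⟩⟨fₙ|`. -/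
def sumKernel (f : ι → L2R) (p : ℝ × ℝ) : ℂ := ∑' i, f i p.1 * (starRingEnd ℂ) (f i p.2)

/-- The operator acts through its kernel: the series `∑ ⟨fₙ, ψ⟩ fₙ` converges normally in `L²`,
hence almost everywhere, and its sum at `x` may be exchanged with the integral over `y`. -/
theorem isHilbertSchmidtKernel_sumKernel [Countable ι] {f : ι → L2R} (hf : ∑' i, ‖f i‖ₑ ^ 2 ≠ ⊤)
    {P : L2R →L[ℂ] L2R} (hP : ∀ ψ, HasSum (fun i => inner ℂ (f i) ψ • f i) (P ψ)) :
    IsHilbertSchmidtKernel P (sumKernel f) := by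
  refine ⟨memLp_tsum (fun i => memLp_mul_conj (measurable_coeFn _) (measurable_coeFn _)
    (Lp.memLp _) (Lp.memLp _)) ?_, fun ψ => ?_⟩
  · simp_rw [eLpNorm_mul_conj (measurable_coeFn _) (measurable_coeFn _), ← Lp.enorm_def, ← sq]
    exact hf
  have hs : ∑' i, (‖f i‖ₑ * ‖ψ‖ₑ) * ‖f i‖ₑ ≠ ⊤ := by
    have h : ∑' i, (‖f i‖ₑ * ‖ψ‖ₑ) * ‖f i‖ₑ = (∑' i, ‖f i‖ₑ ^ 2) * ‖ψ‖ₑ := by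
      rw [← ENNReal.tsum_mul_right]; congr 1; ext i; ring
    rw [h]
    finiteness
  have hin (i) : ‖inner ℂ (f i) ψ‖ₑ ≤ ‖f i‖ₑ * ‖ψ‖ₑ := by
    rw [← ofReal_norm, ← ofReal_norm, ← ofReal_norm, ← ENNReal.ofReal_mul (norm_nonneg _)]
    exact ENNReal.ofReal_le_ofReal (norm_inner_le_norm _ _)
  have h1 : ∀ᵐ x : ℝ, P ψ x = ∑' i, inner ℂ (f i) ψ * f i x := by
    have h := Lp.coeFn_tsum (f := fun i => inner ℂ (f i) ψ • f i)
      (ne_top_of_le_ne_top hs (ENNReal.tsum_le_tsum fun i => by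
        rw [enorm_smul]; gcongr; exact hin i))
    have h2 : ∀ᵐ x : ℝ, ∀ i, (inner ℂ (f i) ψ • f i : L2R) x = inner ℂ (f i) ψ * f i x :=
      ae_all_iff.2 fun i => Lp.coeFn_smul (inner ℂ (f i) ψ) (f i)
    rw [(hP ψ).tsum_eq] at h
    filter_upwards [h, h2] with x hx hx2
    simp [hx, hx2]
  -- for almost every `x` the integrals over `y` of the kernel series are absolutely summable
  have h3 : ∀ᵐ x : ℝ, ∑' i, ‖((‖f i‖ * ‖ψ‖ : ℝ) : ℂ) * f i x‖ₑ ≠ ⊤ := by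
    have := summable_norm_of_tsum_eLpNorm_ne_top (μ := volume) (p := 2) (by norm_num)
      (f := fun i => ((‖f i‖ * ‖ψ‖ : ℝ) : ℂ) • (f i : ℝ → ℂ))
      (fun i => (Lp.aestronglyMeasurable _).const_smul _) (by
        simp_rw [eLpNorm_const_smul, ← Lp.enorm_def]
        convert hs using 4 with i
        rw [← ofReal_norm, Complex.norm_real, norm_mul, norm_norm, norm_norm,
          ENNReal.ofReal_mul (norm_nonneg _), ofReal_norm, ofReal_norm])
    filter_upwards [this] with x hx
    exact tsum_enorm_ne_top_iff_summable_norm.2 hx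
  filter_upwards [h1, h3] with x hx hx3
  have h4 (y : ℝ) : sumKernel f (x, y) * ψ y =
      ∑' i, f i x * ((starRingEnd ℂ) (f i y) * ψ y) := by
    rw [sumKernel, ← tsum_mul_right]
    congr 1; ext i; ring
  have hψ := measurable_coeFn ψ
  have hfm (i) := measurable_coeFn (f i)
  simp_rw [h4]
  rw [integral_tsum (fun i => Measurable.aestronglyMeasurable (by fun_prop))]
  · rw [hx]
    congr 1; ext i
    rw [integral_const_mul, inner_eq_integral, mul_comm]
  · refine ne_top_of_le_ne_top hx3 (ENNReal.tsum_le_tsum fun i => ?_)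
    simp_rw [enorm_mul (f i x)]
    simp_rw [enorm_mul ((starRingEnd ℂ) _), RCLike.enorm_conj]
    rw [lintegral_const_mul _ (by fun_prop), mul_comm, enorm_mul]
    gcongr
    have h := lintegral_enorm_conj_mul_le (f i) ψ
    simp_rw [enorm_mul, RCLike.enorm_conj] at h
    refine h.trans_eq ?_
    rw [← ofReal_norm (((‖f i‖ * ‖ψ‖ : ℝ) : ℂ)), Complex.norm_real, norm_mul, norm_norm, norm_norm,
      ENNReal.ofReal_mul (norm_nonneg _), ofReal_norm, ofReal_norm]

/-- The Wigner function of `∑ |fₙ⟩⟨fₙ|`, as a uniformly convergent sum of Wigner transforms. -/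
def sumWigner (f : ι → L2R) (z : ℝ × ℝ) : ℝ :=
  1 / (2 * Real.pi) * ∑' i, (crossWigner (f i) (f i) z).re

theorem crossWigner_self_eq_ofReal (f : ℝ → ℂ) (z : ℝ × ℝ) :
    crossWigner f f z = ((crossWigner f f z).re : ℂ) :=
  (Complex.conj_eq_iff_re.1 (conj_crossWigner f f z)).symm

theorem isWignerFunction_sumWigner [Countable ι] {f : ι → L2R} (hf : ∑' i, ‖f i‖ₑ ^ 2 ≠ ⊤)
    {P : L2R →L[ℂ] L2R} (hP : ∀ ψ, HasSum (fun i => inner ℂ (f i) ψ • f i) (P ψ)) :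
    IsWignerFunction P (sumWigner f) := by
  have hfm (i) := measurable_coeFn (f i)
  have hle (i) (z : ℝ × ℝ) : ‖crossWigner (f i) (f i) z‖ₑ ≤ 2 * ‖f i‖ₑ ^ 2 := by
    rw [sq, Lp.enorm_def]
    exact enorm_crossWigner_le (hfm i) (hfm i) z
  have hs : ∑' i, 2 * ‖f i‖ₑ ^ 2 ≠ ⊤ := by
    rw [ENNReal.tsum_mul_left]; finiteness
  refine ⟨?_, sumKernel f, isHilbertSchmidtKernel_sumKernel hf hP,
    Filter.Eventually.of_forall fun x => ⟨?_, fun ξ => ?_⟩⟩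
  · refine continuous_const.mul (continuous_tsum (u := fun i => (2 * ‖f i‖ₑ ^ 2).toReal)
      (fun i => Complex.continuous_re.comp (continuous_crossWigner_self (hfm i) (Lp.memLp _)))
      (ENNReal.summable_toReal hs) fun i z => ?_)
    refine (Complex.abs_re_le_norm _).trans ?_
    rw [← toReal_enorm]
    exact ENNReal.toReal_mono (by finiteness) (hle i z)
  · have hint (i) : Integrable fun y : ℝ =>
        f i (x + y / 2) * (starRingEnd ℂ) (f i (x - y / 2)) := by
      simpa using integrable_crossWigner (hfm i) (hfm i) (Lp.memLp _) (Lp.memLp _) (x, 0)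
    rw [← memLp_one_iff_integrable]
    refine memLp_tsum (fun i => memLp_one_iff_integrable.2 (hint i)) ?_
    refine ne_top_of_le_ne_top hs (ENNReal.tsum_le_tsum fun i => ?_)
    rw [eLpNorm_one_eq_lintegral_enorm, sq, Lp.enorm_def]
    simpa [enorm_mul] using lintegral_enorm_mul_le (hfm i) (hfm i) x
  · simp_rw [sumKernel, ← tsum_mul_left]
    rw [integral_tsum (fun i => Measurable.aestronglyMeasurable (by fun_prop))]
    · rw [sumWigner]
      push_cast
      simp_rw [← crossWigner_self_eq_ofReal]
      rfl
    · refine ne_top_of_le_ne_top hs (ENNReal.tsum_le_tsum fun i => ?_)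
      rw [sq, Lp.enorm_def]
      exact lintegral_enorm_crossWigner_le (hfm i) (hfm i) (x, ξ)

theorem enorm_sumWigner_le (f : ι → L2R) (z : ℝ × ℝ) :
    ‖sumWigner f z‖ₑ ≤ ∑' i, ‖f i‖ₑ ^ 2 := by
  have hfm (i) := measurable_coeFn (f i)
  have h2 : ‖1 / (2 * Real.pi)‖ₑ * 2 ≤ 1 := by
    rw [← ofReal_norm, ← ENNReal.ofReal_ofNat, ← ENNReal.ofReal_mul (norm_nonneg _)]
    refine ENNReal.ofReal_le_one.2 ?_
    rw [Real.norm_of_nonneg (by positivity), div_mul_eq_mul_div, div_le_one (by positivity)]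
    linarith [Real.pi_gt_three]
  calc ‖sumWigner f z‖ₑ ≤ ‖1 / (2 * Real.pi)‖ₑ * ∑' i, 2 * ‖f i‖ₑ ^ 2 := by
        rw [sumWigner, enorm_mul]
        gcongr
        refine enorm_tsum_le_tsum_enorm.trans (ENNReal.tsum_le_tsum fun i => ?_)
        refine le_trans ?_ (b := ‖crossWigner (f i) (f i) z‖ₑ) ?_
        · rw [← ofReal_norm, ← ofReal_norm]
          exact ENNReal.ofReal_le_ofReal (Complex.abs_re_le_norm _)
        · rw [sq, Lp.enorm_def]
          exact enorm_crossWigner_le (hfm i) (hfm i) z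
    _ = (‖1 / (2 * Real.pi)‖ₑ * 2) * ∑' i, ‖f i‖ₑ ^ 2 := by
        rw [ENNReal.tsum_mul_left, mul_assoc]
    _ ≤ _ := mul_le_of_le_one_left zero_le h2

/-- A positive trace-class operator has a Wigner function, which is bounded by its trace (even by
`1 / π` times the trace). -/
theorem exists_isWignerFunction {P : L2R →L[ℂ] L2R} (hP : 0 ≤ P) (h : traceNorm P ≠ ⊤) :
    ∃ W, IsWignerFunction P W ∧ ∀ z, ‖W z‖ₑ ≤ traceNorm P := by
  rw [traceNorm_of_nonneg hP] at h ⊢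
  exact ⟨_, isWignerFunction_sumWigner h (hasSum_inner_sqrt_smul hP), enorm_sumWigner_le _⟩

end Kernel

/-! ### Linearity and uniqueness of Wigner functions -/

section Uniqueness

theorem ae_memLp_two_slice {K : ℝ × ℝ → ℂ} (hK : MemLp K 2 volume) :
    ∀ᵐ x : ℝ, MemLp (fun y => K (x, y)) 2 volume := by
  have hK1 : AEStronglyMeasurable K ((volume : Measure ℝ).prod volume) := hK.1
  have h : ∫⁻ p : ℝ × ℝ, ‖K p‖ₑ ^ 2 ≠ ⊤ := by
    intro htop
    have := hK.2
    rw [eLpNorm_two_eq, htop] at this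
    simp at this
  rw [Measure.volume_eq_prod, lintegral_prod _ (hK1.enorm.pow_const 2)] at h
  filter_upwards [hK1.prodMk_left, ae_lt_top' (hK1.enorm.pow_const 2).lintegral_prod_right' h]
    with x hx hx2
  refine ⟨hx, ?_⟩
  rw [eLpNorm_two_eq]
  exact ENNReal.rpow_lt_top_of_nonneg (by norm_num) hx2.ne

theorem integrable_slice_mul {k : ℝ → ℂ} (hk : MemLp k 2) (ψ : L2R) :
    Integrable fun y => k y * ψ y :=
  hk.integrable_mul (Lp.memLp ψ)

theorem IsHilbertSchmidtKernel.linearCombination {ρ σ : L2R →L[ℂ] L2R} {K L : ℝ × ℝ → ℂ}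
    (hK : IsHilbertSchmidtKernel ρ K) (hL : IsHilbertSchmidtKernel σ L) (a b : ℂ) :
    IsHilbertSchmidtKernel (a • ρ + b • σ) fun p => a * K p + b * L p := by
  refine ⟨(hK.1.const_mul a).add (hL.1.const_mul b), fun ψ => ?_⟩
  have h : ∀ᵐ x : ℝ, (a • ρ + b • σ) ψ x = a * ρ ψ x + b * σ ψ x := by
    filter_upwards [Lp.coeFn_add (a • ρ ψ) (b • σ ψ), Lp.coeFn_smul a (ρ ψ),
      Lp.coeFn_smul b (σ ψ)] with x h1 h2 h3
    rw [add_apply, smul_apply, smul_apply, h1, Pi.add_apply, h2, h3]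
    rfl
  filter_upwards [h, hK.2 ψ, hL.2 ψ, ae_memLp_two_slice hK.1, ae_memLp_two_slice hL.1]
    with x h1 h2 h3 h4 h5
  rw [h1, h2, h3, ← integral_const_mul, ← integral_const_mul,
    ← integral_add ((integrable_slice_mul h4 ψ).const_mul a)
      ((integrable_slice_mul h5 ψ).const_mul b)]
  congr 1; ext y; ring

theorem IsWignerFunction.linearCombination {ρ σ : L2R →L[ℂ] L2R} {V W : ℝ × ℝ → ℝ}
    (hV : IsWignerFunction ρ V) (hW : IsWignerFunction σ W) (a b : ℝ) :
    IsWignerFunction ((a : ℂ) • ρ + (b : ℂ) • σ) fun z => a * V z + b * W z := by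
  obtain ⟨hVc, K, hK, hKV⟩ := hV
  obtain ⟨hWc, L, hL, hLW⟩ := hW
  refine ⟨by fun_prop, _, hK.linearCombination hL a b, ?_⟩
  filter_upwards [hKV, hLW] with x ⟨h1, h2⟩ ⟨h3, h4⟩
  refine ⟨(h1.const_mul _).add (h3.const_mul _), fun ξ => ?_⟩
  have hexp {F : ℝ → ℂ} (hF : Integrable F) :
      Integrable fun y : ℝ => Complex.exp (-(Complex.I * (ξ : ℂ) * (y : ℂ))) * F y :=
    hF.bdd_mul (c := 1) (Measurable.aestronglyMeasurable (by fun_prop))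
      (Filter.Eventually.of_forall fun y => (norm_cexp_neg_I_mul ξ y).le)
  push_cast
  rw [h2, h4]
  simp_rw [mul_add, mul_left_comm (Complex.exp _)]
  rw [integral_add ((hexp h1).const_mul _) ((hexp h3).const_mul _), integral_const_mul,
    integral_const_mul]
  ring

theorem eq_zero_ae_of_forall_integral_mul_denseSeq {k : ℝ → ℂ} (hk : MemLp k 2)
    (h : ∀ n, ∫ y, k y * TopologicalSpace.denseSeq L2R n y = 0) : k =ᵐ[volume] 0 := by
  set d : L2R := MemLp.toLp _ hk.star
  have hd : d =ᵐ[volume] star k := hk.star.coeFn_toLp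
  have h0 (n) : inner ℂ d (TopologicalSpace.denseSeq L2R n) = 0 := by
    rw [inner_eq_integral, ← h n]
    refine integral_congr_ae ?_
    filter_upwards [hd] with y hy
    simp [hy]
  have h1 : ∀ ψ : L2R, inner ℂ d ψ = 0 := by
    have hc : Continuous fun ψ : L2R => inner ℂ d ψ := by fun_prop
    exact congr_fun ((TopologicalSpace.denseRange_denseSeq L2R).equalizer hc continuous_const
      (funext h0))
  have h2 : d = 0 := inner_self_eq_zero.1 (h1 d)
  have h3 := Lp.coeFn_zero ℂ 2 (volume : Measure ℝ)
  rw [h2] at hd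
  filter_upwards [hd, h3] with y hy hy3
  rw [hy3] at hy
  simpa using hy.symm

/-- The Hilbert–Schmidt kernel is unique almost everywhere: testing against a countable dense
sequence in `L²` needs only countably many null sets of `x`. -/
theorem IsHilbertSchmidtKernel.ae_eq {ρ : L2R →L[ℂ] L2R} {K L : ℝ × ℝ → ℂ}
    (hK : IsHilbertSchmidtKernel ρ K) (hL : IsHilbertSchmidtKernel ρ L) :
    K =ᵐ[volume] L := by
  have h1 : ∀ᵐ x : ℝ, ∀ᵐ y : ℝ, K (x, y) = L (x, y) := by
    have hKn : ∀ᵐ x : ℝ, ∀ n, ρ (TopologicalSpace.denseSeq L2R n) x =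
        ∫ y : ℝ, K (x, y) * TopologicalSpace.denseSeq L2R n y := ae_all_iff.2 fun n => hK.2 _
    have hLn : ∀ᵐ x : ℝ, ∀ n, ρ (TopologicalSpace.denseSeq L2R n) x =
        ∫ y : ℝ, L (x, y) * TopologicalSpace.denseSeq L2R n y := ae_all_iff.2 fun n => hL.2 _
    filter_upwards [hKn, hLn, ae_memLp_two_slice hK.1, ae_memLp_two_slice hL.1]
      with x h1 h2 h3 h4
    have := eq_zero_ae_of_forall_integral_mul_denseSeq (h3.sub h4) fun n => by
      simp only [Pi.sub_apply, sub_mul]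
      rw [integral_sub (integrable_slice_mul h3 _) (integrable_slice_mul h4 _), ← h1, ← h2,
        sub_self]
    filter_upwards [this] with y hy
    exact sub_eq_zero.1 hy
  have hm : AEStronglyMeasurable (fun p => K p - L p) ((volume : Measure ℝ).prod volume) :=
    (hK.1.sub hL.1).1
  have h2 : ∀ᵐ p ∂(volume : Measure ℝ).prod volume, hm.mk _ p = 0 := by
    refine (Measure.ae_prod_iff_ae_ae
      (measurableSet_eq_fun hm.stronglyMeasurable_mk.measurable measurable_const)).2 ?_
    filter_upwards [h1, Measure.ae_ae_of_ae_prod hm.ae_eq_mk] with x hx hx2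
    filter_upwards [hx, hx2] with y hy hy2
    rw [← hy2, hy, sub_self]
  rw [Measure.volume_eq_prod]
  filter_upwards [h2, hm.ae_eq_mk] with p hp hp2
  exact sub_eq_zero.1 (hp2.trans hp)

/-- The change of variables `(x, y) ↦ (x + y/2, x - y/2)`. -/
def midpointEquiv : (ℝ × ℝ) ≃ₗ[ℝ] (ℝ × ℝ) where
  toFun p := (p.1 + p.2 / 2, p.1 - p.2 / 2)
  invFun p := ((p.1 + p.2) / 2, p.1 - p.2)
  map_add' p q := by ext <;> simp <;> ring
  map_smul' c p := by ext <;> simp <;> ring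
  left_inv p := by ext <;> simp
  right_inv p := by ext <;> simp <;> ring

theorem ae_ae_midpoint {p : ℝ × ℝ → Prop} (h : ∀ᵐ z : ℝ × ℝ, p z) :
    ∀ᵐ x : ℝ, ∀ᵐ y : ℝ, p (x + y / 2, x - y / 2) := by
  have hq := Measure.LinearMap.quasiMeasurePreserving (volume : Measure (ℝ × ℝ))
    (midpointEquiv : (ℝ × ℝ) →ₗ[ℝ] (ℝ × ℝ)) (LinearEquiv.isUnit_det' _).ne_zero
  exact Measure.ae_ae_of_ae_prod (hq.ae h)

/-- A Wigner function is determined by the operator: the kernel is determined almost everywhere,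
hence so are the Wigner integrals for almost every `x`, and continuity does the rest. -/
theorem IsWignerFunction.unique {ρ : L2R →L[ℂ] L2R} {V W : ℝ × ℝ → ℝ}
    (hV : IsWignerFunction ρ V) (hW : IsWignerFunction ρ W) : V = W := by
  obtain ⟨hVc, K, hK, hKV⟩ := hV
  obtain ⟨hWc, L, hL, hLW⟩ := hW
  have h : ∀ᵐ x : ℝ, ∀ ξ : ℝ, V (x, ξ) = W (x, ξ) := by
    filter_upwards [hKV, hLW, ae_ae_midpoint (hK.ae_eq hL)] with x h1 h2 h3 ξ
    rw [← Complex.ofReal_inj, h1.2 ξ, h2.2 ξ]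
    congr 1
    refine integral_congr_ae ?_
    filter_upwards [h3] with y hy
    rw [hy]
  funext z
  have hd : Dense {x : ℝ | ∀ ξ : ℝ, V (x, ξ) = W (x, ξ)} := Measure.dense_of_ae h
  have := Continuous.ext_on hd (f := fun x => V (x, z.2)) (g := fun x => W (x, z.2))
    (by fun_prop) (by fun_prop) fun x hx => hx z.2
  exact congr_fun this z.1

end Uniqueness

/-! ### Trace-norm closedness of the Wigner-positive states -/

section Closure

/-- For positive operators trace and trace norm agree, so the density matrices are the positive
operators of unit trace norm. -/
theorem mem_densityMatrices_iff {H : Type*} [NormedAddCommGroup H] [InnerProductSpace ℂ H]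
    [CompleteSpace H] {ρ : H →L[ℂ] H} :
    ρ ∈ densityMatrices H ↔ 0 ≤ ρ ∧ traceNorm ρ = 1 := by
  constructor
  · rintro ⟨hfin, -, htr, hpos⟩
    have h0 := (ContinuousLinearMap.nonneg_iff_isPositive ρ).2 hpos
    refine ⟨h0, ?_⟩
    rw [trace_eq_toReal_traceNorm h0] at htr
    rw [← ENNReal.ofReal_toReal (LT.lt.ne hfin), Complex.ofReal_eq_one.1 htr, ENNReal.ofReal_one]
  · rintro ⟨h0, h1⟩
    refine ⟨?_, h0.isSelfAdjoint, ?_, (ContinuousLinearMap.nonneg_iff_isPositive ρ).1 h0⟩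
    · rw [traceClass, Set.mem_ofPred_eq, h1]; exact ENNReal.one_lt_top
    · rw [trace_eq_toReal_traceNorm h0, h1]; simp

theorem densityMatrices_closed {H : Type*} [NormedAddCommGroup H] [InnerProductSpace ℂ H]
    [CompleteSpace H] : traceClosure (densityMatrices H) ⊆ densityMatrices H := by
  rintro A ⟨hA, hlim⟩
  have h0 : 0 ≤ A := by
    have hcl : IsClosed {T : H →L[ℂ] H | 0 ≤ T} := isClosed_Ici
    refine hcl.closure_subset (EMetric.mem_closure_iff.2 fun ε hε => ?_)
    obtain ⟨B, hB, hAB⟩ := hlim ε hε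
    refine ⟨B, (mem_densityMatrices_iff.1 hB).1, ?_⟩
    rw [edist_eq_enorm_sub]
    exact (enorm_le_traceNorm _).trans_lt hAB
  refine ⟨hA, h0.isSelfAdjoint, ?_, (ContinuousLinearMap.nonneg_iff_isPositive A).1 h0⟩
  rw [← sub_eq_zero, ← enorm_eq_zero]
  refine le_antisymm (le_of_forall_gt fun ε hε => ?_) zero_le
  obtain ⟨B, hB, hAB⟩ := hlim ε hε
  rw [← hB.2.2.1]
  exact (enorm_trace_sub_le h0 (mem_densityMatrices_iff.1 hB).1 (LT.lt.ne hA)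
    (LT.lt.ne hB.1)).trans_lt hAB

/-- Wigner functions depend continuously, for the uniform norm, on the operator in trace norm. -/
theorem IsWignerFunction.enorm_sub_le {A B : L2R →L[ℂ] L2R} {V W : ℝ × ℝ → ℝ}
    (hV : IsWignerFunction A V) (hW : IsWignerFunction B W) (hAB : IsSelfAdjoint (A - B))
    (hfin : traceNorm (A - B) ≠ ⊤) (z : ℝ × ℝ) :
    ‖V z - W z‖ₑ ≤ 2 * traceNorm (A - B) := by
  obtain ⟨P, N, hP0, hN0, hPN, hP, hN⟩ := exists_nonneg_sub_nonneg hAB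
  obtain ⟨X, hX, hXle⟩ := exists_isWignerFunction hP0 (ne_top_of_le_ne_top hfin hP)
  obtain ⟨Y, hY, hYle⟩ := exists_isWignerFunction hN0 (ne_top_of_le_ne_top hfin hN)
  -- `A + N = B + P`, so additivity and uniqueness compare the Wigner functions
  have h1 := hV.linearCombination hY 1 1
  have h2 := hW.linearCombination hX 1 1
  have h3 : ((1 : ℝ) : ℂ) • A + ((1 : ℝ) : ℂ) • N = ((1 : ℝ) : ℂ) • B + ((1 : ℝ) : ℂ) • P := by
    simp only [Complex.ofReal_one, one_smul]
    rw [← sub_eq_zero, show A + N - (B + P) = (A - B) - (P - N) by abel, hPN, sub_self]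
  rw [h3] at h1
  have h4 := congr_fun (h1.unique h2) z
  have h5 : V z - W z = X z - Y z := by simp only [one_mul] at h4; linarith
  rw [h5, two_mul]
  exact _root_.enorm_sub_le.trans (add_le_add ((hXle z).trans hP) ((hYle z).trans hN))

theorem wignerPositiveStates_closed :
    traceClosure wignerPositiveStates ⊆ wignerPositiveStates := by
  rintro A ⟨hA, hlim⟩
  have hAD : A ∈ densityMatrices L2R := densityMatrices_closed ⟨hA, fun ε hε =>
    let ⟨B, hB, h⟩ := hlim ε hε
    ⟨B, hB.1, h⟩⟩
  have hA0 := (mem_densityMatrices_iff.1 hAD).1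
  obtain ⟨V, hV, -⟩ := exists_isWignerFunction hA0 (LT.lt.ne hA)
  refine ⟨hAD, V, hV, fun z => ?_⟩
  by_contra! hz
  obtain ⟨B, ⟨hB, W, hW, hW0⟩, hAB⟩ := hlim (ENNReal.ofReal (-V z / 2)) (by simpa using hz)
  have h := hV.enorm_sub_le hW
    (hA0.isSelfAdjoint.sub (mem_densityMatrices_iff.1 hB).1.isSelfAdjoint) hAB.ne_top z
  have h2 : ‖V z - W z‖ₑ < ENNReal.ofReal (-V z) := by
    refine h.trans_lt ?_
    rw [show -V z = 2 * (-V z / 2) by ring, ENNReal.ofReal_mul (by norm_num), ENNReal.ofReal_ofNat]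
    exact ENNReal.mul_lt_mul_right two_ne_zero ENNReal.ofNat_ne_top hAB
  rw [← ofReal_norm, Real.norm_eq_abs, ENNReal.ofReal_lt_ofReal_iff (by linarith)] at h2
  linarith [(abs_lt.1 h2).1, hW0 z]

end Closure

/-! ### Moments of modulated Gaussians -/

section Gaussian

theorem hasDerivAt_cexp_gaussian (b t y : ℝ) :
    HasDerivAt (fun y : ℝ => Complex.exp (-b * y ^ 2 + Complex.I * t * y))
      ((-(2 * b * y) + Complex.I * t) * Complex.exp (-b * y ^ 2 + Complex.I * t * y)) y := by
  have h1 : HasDerivAt (fun y : ℂ => Complex.exp (-b * y ^ 2 + Complex.I * t * y))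
      (Complex.exp (-b * y ^ 2 + Complex.I * t * y) * (-b * (2 * y) + Complex.I * t)) (y : ℂ) := by
    refine HasDerivAt.cexp (HasDerivAt.add (HasDerivAt.const_mul _ ?_) ?_)
    · simpa using hasDerivAt_pow 2 (y : ℂ)
    · simpa using (hasDerivAt_id (y : ℂ)).const_mul (Complex.I * t)
  convert h1.comp_ofReal using 1
  ring

theorem norm_cexp_gaussian (b t y : ℝ) :
    ‖Complex.exp (-b * y ^ 2 + Complex.I * t * y)‖ = Real.exp (-b * y ^ 2) := by
  rw [Complex.norm_exp]
  congr 1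
  simp [← Complex.ofReal_pow]

theorem integrable_pow_mul_cexp_gaussian {b : ℝ} (hb : 0 < b) (t : ℝ) (n : ℕ) :
    Integrable fun y : ℝ => (y : ℂ) ^ n * Complex.exp (-b * y ^ 2 + Complex.I * t * y) := by
  have h := integrable_rpow_mul_exp_neg_mul_sq hb (s := n) (by linarith [n.cast_nonneg (α := ℝ)])
  refine h.mono (Measurable.aestronglyMeasurable (by fun_prop)) (Filter.Eventually.of_forall
    fun y => ?_)
  rw [norm_mul, norm_mul, norm_cexp_gaussian, Real.rpow_natCast]
  simp

theorem integral_cexp_gaussian {b : ℝ} (hb : 0 < b) (t : ℝ) :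
    ∫ y : ℝ, Complex.exp (-b * y ^ 2 + Complex.I * t * y) =
      (√(Real.pi / b) * Real.exp (-t ^ 2 / (4 * b)) : ℝ) := by
  have h := integral_cexp_quadratic (b := -b) (by simpa using hb) (Complex.I * t) 0
  simp only [add_zero] at h
  rw [h, Complex.ofReal_mul, Real.sqrt_eq_rpow, Complex.ofReal_cpow (by positivity),
    Complex.ofReal_exp]
  push_cast
  congr 2
  · simp
  · rw [mul_pow, Complex.I_sq]
    have : (b : ℂ) ≠ 0 := by exact_mod_cast hb.ne'
    field

/-- Second moment of a modulated Gaussian, by integrating the derivatives of `g` and `y g`. -/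
theorem integral_sq_mul_cexp_gaussian {b : ℝ} (hb : 0 < b) (t : ℝ) :
    ∫ y : ℝ, (y : ℂ) ^ 2 * Complex.exp (-b * y ^ 2 + Complex.I * t * y) =
      ((1 / (2 * b) - t ^ 2 / (4 * b ^ 2)) *
        (√(Real.pi / b) * Real.exp (-t ^ 2 / (4 * b))) : ℝ) := by
  set g : ℝ → ℂ := fun y => Complex.exp (-b * y ^ 2 + Complex.I * t * y) with hg
  have hi (n : ℕ) := integrable_pow_mul_cexp_gaussian hb t n
  have i0 : Integrable g := by simpa [hg] using hi 0
  have i1 : Integrable fun y : ℝ => (y : ℂ) * g y := by simpa [hg] using hi 1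
  have i2 : Integrable fun y : ℝ => (y : ℂ) ^ 2 * g y := hi 2
  have e0 : ∀ y : ℝ, (-(2 * b * y) + Complex.I * t) * g y =
      -(2 * b) * (y * g y) + (Complex.I * t) * g y := fun y => by ring
  have e1 : ∀ y : ℝ, 1 * g y + y * ((-(2 * b * y) + Complex.I * t) * g y) =
      g y + (-(2 * b) * (y ^ 2 * g y) + (Complex.I * t) * (y * g y)) := fun y => by ring
  have h0 := integral_eq_zero_of_hasDerivAt_of_integrable (hasDerivAt_cexp_gaussian b t)
    (((i1.const_mul (-(2 * b : ℂ))).add (i0.const_mul (Complex.I * t))).congr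
      (Filter.Eventually.of_forall fun y => (e0 y).symm)) i0
  have h1 := integral_eq_zero_of_hasDerivAt_of_integrable
    (fun y : ℝ => (hasDerivAt_id y).ofReal_comp.mul (hasDerivAt_cexp_gaussian b t y))
    ((i0.add ((i2.const_mul (-(2 * b : ℂ))).add (i1.const_mul (Complex.I * t)))).congr
      (Filter.Eventually.of_forall fun y => by simpa [hg] using (e1 y).symm)) i1
  simp only [id, Complex.ofReal_one] at h1
  change ∫ y : ℝ, (-(2 * b * y) + Complex.I * t) * g y = 0 at h0
  change ∫ y : ℝ, 1 * g y + y * ((-(2 * b * y) + Complex.I * t) * g y) = 0 at h1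
  simp_rw [e0] at h0
  simp_rw [e1] at h1
  rw [integral_add (i1.const_mul _) (i0.const_mul _), integral_const_mul, integral_const_mul] at h0
  have i3 : Integrable fun y : ℝ =>
      -(2 * b : ℂ) * ((y : ℂ) ^ 2 * g y) + Complex.I * t * (y * g y) :=
    (i2.const_mul _).add (i1.const_mul _)
  rw [integral_add i0 i3, integral_add (i2.const_mul _) (i1.const_mul _),
    integral_const_mul, integral_const_mul] at h1
  have hI : ∫ y, g y = (√(Real.pi / b) * Real.exp (-t ^ 2 / (4 * b)) : ℝ) :=
    integral_cexp_gaussian hb t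
  rw [Complex.ofReal_mul, ← hI]
  have hb' : (b : ℂ) ≠ 0 := by exact_mod_cast hb.ne'
  have h2 : ∫ y : ℝ, (y : ℂ) * g y = Complex.I * t / (2 * b) * ∫ y, g y := by
    field_simp
    linear_combination -h0
  rw [h2] at h1
  push_cast
  change ∫ y : ℝ, (y : ℂ) ^ 2 * g y = _
  field_simp at h1 ⊢
  linear_combination (-2 * h1) + 2 * t ^ 2 * (∫ y, g y) * Complex.I_sq

end Gaussian

/-! ### The translated first excited state -/

section ExcitedState

/-- The first excited state of the harmonic oscillator, translated to the point `(x₀, ξ₀)` of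
phase space. -/
def excitedState (x₀ ξ₀ u : ℝ) : ℂ :=
  (√(2 / √Real.pi) : ℝ) * (u - x₀ : ℝ) *
    Complex.exp ((-(u - x₀) ^ 2 / 2 : ℝ) + Complex.I * ξ₀ * u)

/-- The Wigner function of `excitedState x₀ ξ₀`. -/
def excitedWigner (x₀ ξ₀ : ℝ) (z : ℝ × ℝ) : ℝ :=
  1 / Real.pi * (2 * ((z.1 - x₀) ^ 2 + (z.2 - ξ₀) ^ 2) - 1) *
    Real.exp (-((z.1 - x₀) ^ 2 + (z.2 - ξ₀) ^ 2))

theorem continuous_excitedState (x₀ ξ₀ : ℝ) : Continuous (excitedState x₀ ξ₀) := by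
  unfold excitedState; fun_prop

theorem continuous_excitedWigner (x₀ ξ₀ : ℝ) : Continuous (excitedWigner x₀ ξ₀) := by
  unfold excitedWigner; fun_prop

theorem norm_excitedState_sq (x₀ ξ₀ u : ℝ) :
    ‖excitedState x₀ ξ₀ u‖ ^ 2 = 2 / √Real.pi * ((u - x₀) ^ 2 * Real.exp (-1 * (u - x₀) ^ 2)) := by
  have h : ‖Complex.exp ((-(u - x₀) ^ 2 / 2 : ℝ) + Complex.I * ξ₀ * u)‖ =
      Real.exp (-(u - x₀) ^ 2 / 2) := by
    rw [Complex.norm_exp]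
    congr 1
    simp
    norm_cast
  rw [excitedState, norm_mul, norm_mul, h, Complex.norm_real, Complex.norm_real, mul_pow, mul_pow,
    Real.norm_eq_abs, Real.norm_eq_abs, sq_abs, sq_abs, Real.sq_sqrt (by positivity),
    ← Real.exp_nat_mul, mul_assoc]
  congr 3
  push_cast; ring

theorem integrable_sq_mul_gaussian : Integrable fun u : ℝ => u ^ 2 * Real.exp (-1 * u ^ 2) := by
  simpa using integrable_rpow_mul_exp_neg_mul_sq one_pos (s := 2) (by norm_num)

theorem integral_sq_mul_gaussian : ∫ u : ℝ, u ^ 2 * Real.exp (-1 * u ^ 2) = √Real.pi / 2 := by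
  have h := integral_sq_mul_cexp_gaussian one_pos 0
  rw [← Complex.ofReal_inj, ← integral_complex_ofReal]
  convert h using 2
  · ext u; simp
  · simp
  · norm_num; ring

theorem lintegral_enorm_excitedState_sq (x₀ ξ₀ : ℝ) :
    ∫⁻ u, ‖excitedState x₀ ξ₀ u‖ₑ ^ 2 = 1 := by
  have h (u : ℝ) : ‖excitedState x₀ ξ₀ u‖ₑ ^ 2 =
      ENNReal.ofReal (2 / √Real.pi * ((u - x₀) ^ 2 * Real.exp (-1 * (u - x₀) ^ 2))) := by
    rw [← norm_excitedState_sq x₀ ξ₀, ENNReal.ofReal_pow (norm_nonneg _), ofReal_norm]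
  simp_rw [h]
  rw [lintegral_sub_right_eq_self
      (fun u => ENNReal.ofReal (2 / √Real.pi * (u ^ 2 * Real.exp (-1 * u ^ 2)))) x₀,
    ← ofReal_integral_eq_lintegral_ofReal (integrable_sq_mul_gaussian.const_mul _)
      (Filter.Eventually.of_forall fun u => by positivity), integral_const_mul,
    integral_sq_mul_gaussian]
  have : √Real.pi ≠ 0 := by positivity
  rw [show 2 / √Real.pi * (√Real.pi / 2) = 1 by field_simp, ENNReal.ofReal_one]

theorem eLpNorm_excitedState (x₀ ξ₀ : ℝ) : eLpNorm (excitedState x₀ ξ₀) 2 volume = 1 := by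
  rw [eLpNorm_two_eq, lintegral_enorm_excitedState_sq, ENNReal.one_rpow]

theorem memLp_excitedState (x₀ ξ₀ : ℝ) : MemLp (excitedState x₀ ξ₀) 2 volume :=
  ⟨(continuous_excitedState x₀ ξ₀).aestronglyMeasurable, by
    rw [eLpNorm_excitedState]; exact ENNReal.one_lt_top⟩

theorem crossWigner_excitedState (x₀ ξ₀ : ℝ) (z : ℝ × ℝ) :
    crossWigner (excitedState x₀ ξ₀) (excitedState x₀ ξ₀) z =
      (2 * Real.pi * excitedWigner x₀ ξ₀ z : ℝ) := by
  set a := z.1 - x₀ with ha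
  set t := ξ₀ - z.2 with ht
  set g : ℝ → ℂ := fun y => Complex.exp (-((1 / 4 : ℝ) : ℂ) * y ^ 2 + Complex.I * t * y) with hg
  have hpt (y : ℝ) : Complex.exp (-(Complex.I * (z.2 : ℂ) * (y : ℂ))) *
      (excitedState x₀ ξ₀ (z.1 + y / 2) * (starRingEnd ℂ) (excitedState x₀ ξ₀ (z.1 - y / 2))) =
      (2 / √Real.pi * Real.exp (-a ^ 2) : ℝ) * (a ^ 2 * g y - 1 / 4 * (y ^ 2 * g y)) := by
    have hs : ((√(2 / √Real.pi) : ℝ) : ℂ) ^ 2 = (2 / √Real.pi : ℝ) := by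
      rw [← Complex.ofReal_pow, Real.sq_sqrt (by positivity)]
    have he : Complex.exp (-(Complex.I * (z.2 : ℂ) * (y : ℂ))) *
        Complex.exp ((-(z.1 + y / 2 - x₀) ^ 2 / 2 : ℝ) + Complex.I * ξ₀ * (z.1 + y / 2 : ℝ)) *
        Complex.exp ((-(z.1 - y / 2 - x₀) ^ 2 / 2 : ℝ) + -Complex.I * ξ₀ * (z.1 - y / 2 : ℝ)) =
        (Real.exp (-a ^ 2) : ℝ) * g y := by
      rw [hg, Complex.ofReal_exp, ← Complex.exp_add, ← Complex.exp_add, ← Complex.exp_add]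
      congr 1
      rw [ha, ht]
      push_cast
      ring
    simp only [excitedState, map_mul, ← Complex.exp_conj, map_add, Complex.conj_ofReal,
      Complex.conj_I]
    rw [Complex.ofReal_mul, ← hs]
    have h1 : ((z.1 + y / 2 - x₀ : ℝ) : ℂ) * (z.1 - y / 2 - x₀ : ℝ) = a ^ 2 - 1 / 4 * y ^ 2 := by
      rw [ha]; push_cast; ring
    linear_combination ((√(2 / √Real.pi) : ℝ) : ℂ) ^ 2 * (((z.1 + y / 2 - x₀ : ℝ) : ℂ) *
      (z.1 - y / 2 - x₀ : ℝ)) * he + ((√(2 / √Real.pi) : ℝ) : ℂ) ^ 2 *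
      ((Real.exp (-a ^ 2) : ℝ) * g y) * h1
  have hb : (0 : ℝ) < 1 / 4 := by norm_num
  have i0 : Integrable g := by simpa [hg] using integrable_pow_mul_cexp_gaussian hb t 0
  have i2 : Integrable fun y : ℝ => (y : ℂ) ^ 2 * g y := integrable_pow_mul_cexp_gaussian hb t 2
  have e0 : ∫ y, g y = _ := integral_cexp_gaussian hb t
  have e2 : ∫ y : ℝ, (y : ℂ) ^ 2 * g y = _ := integral_sq_mul_cexp_gaussian hb t
  have hsq : √(Real.pi / (1 / 4)) = 2 * √Real.pi := by
    rw [show Real.pi / (1 / 4) = 2 ^ 2 * Real.pi by ring, Real.sqrt_mul (by norm_num),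
      Real.sqrt_sq (by norm_num)]
  unfold crossWigner
  simp_rw [hpt]
  rw [integral_const_mul, integral_sub (i0.const_mul _) (i2.const_mul _), integral_const_mul,
    integral_const_mul, e0, e2, hsq]
  have hexp : Real.exp (-((z.1 - x₀) ^ 2 + (z.2 - ξ₀) ^ 2)) =
      Real.exp (-a ^ 2) * Real.exp (-t ^ 2 / (4 * (1 / 4))) := by
    rw [← Real.exp_add, ha, ht]; congr 1; ring
  have hpi : √Real.pi ≠ 0 := by positivity
  rw [excitedWigner, hexp, show (z.2 - ξ₀) ^ 2 = t ^ 2 by rw [ht]; ring, ← ha]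
  norm_cast
  push_cast
  field_simp
  ring

theorem crossWigner_congr {f g : ℝ → ℂ} (hf : Measurable f) (hg : Measurable g) (hf2 : MemLp f 2)
    (hg2 : MemLp g 2) (h : f =ᵐ[volume] g) : crossWigner f f = crossWigner g g := by
  have h0 : eLpNorm (f - g) 2 volume = 0 := by
    rw [eLpNorm_eq_zero_iff (hf.sub hg).aestronglyMeasurable two_ne_zero]
    filter_upwards [h] with x hx
    simp [hx]
  funext z
  have h1 := enorm_crossWigner_le (hf.sub hg) hf z
  have h2 := enorm_crossWigner_le hg (hf.sub hg) z
  rw [h0, zero_mul, mul_zero, nonpos_iff_eq_zero, enorm_eq_zero,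
    crossWigner_sub_left hf hg hf hf2 hg2 hf2, sub_eq_zero] at h1
  rw [h0, mul_zero, mul_zero, nonpos_iff_eq_zero, enorm_eq_zero,
    crossWigner_sub_right hf hg hg hf2 hg2 hg2, sub_eq_zero] at h2
  rw [h1, h2]

/-- The orthogonal projection onto the line of `excitedState x₀ ξ₀`. -/
def excitedProjection (x₀ ξ₀ : ℝ) : L2R →L[ℂ] L2R :=
  InnerProductSpace.rankOne ℂ (memLp_excitedState x₀ ξ₀).toLp (memLp_excitedState x₀ ξ₀).toLp

theorem excitedProjection_mem_densityMatrices (x₀ ξ₀ : ℝ) :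
    excitedProjection x₀ ξ₀ ∈ densityMatrices L2R := by
  have h0 : 0 ≤ excitedProjection x₀ ξ₀ :=
    (ContinuousLinearMap.nonneg_iff_isPositive _).2 (InnerProductSpace.isPositive_rankOne_self _)
  refine mem_densityMatrices_iff.2 ⟨h0, ?_⟩
  have h1 : ‖(memLp_excitedState x₀ ξ₀).toLp‖ₑ ^ 2 = 1 := by
    rw [Lp.enorm_toLp, eLpNorm_excitedState, one_pow]
  rw [traceNorm_eq_tsum_enorm h0, ← h1, enorm_sq_eq_tsum]
  congr 1; ext i
  rw [excitedProjection, InnerProductSpace.rankOne_apply, inner_smul_right, enorm_mul,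
    ← inner_conj_symm, RCLike.enorm_conj, sq]

theorem isWignerFunction_excitedProjection (x₀ ξ₀ : ℝ) :
    IsWignerFunction (excitedProjection x₀ ξ₀) (excitedWigner x₀ ξ₀) := by
  set ψ : L2R := (memLp_excitedState x₀ ξ₀).toLp with hψ
  have h := isWignerFunction_sumWigner (ι := Unit) (f := fun _ => ψ) (by simp)
    (P := excitedProjection x₀ ξ₀) fun φ => by
      convert! hasSum_fintype (fun _ : Unit => inner ℂ ψ φ • ψ) using 1
      simp [excitedProjection, hψ]
  convert h using 1
  funext z
  simp only [sumWigner, tsum_fintype, Finset.univ_unique, Finset.sum_singleton]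
  rw [crossWigner_congr (measurable_coeFn ψ) (continuous_excitedState x₀ ξ₀).measurable
    (Lp.memLp ψ) (memLp_excitedState x₀ ξ₀) (memLp_excitedState x₀ ξ₀).coeFn_toLp,
    crossWigner_excitedState, Complex.ofReal_re]
  have := Real.pi_ne_zero
  field_simp

end ExcitedState

/-! ### Density of the states whose Wigner function vanishes somewhere -/

section Density

open scoped ComplexOrder in
theorem ofReal_smul_nonneg {H : Type*} [NormedAddCommGroup H] [InnerProductSpace ℂ H]
    [CompleteSpace H] {P : H →L[ℂ] H} (hP : 0 ≤ P) {c : ℝ} (hc : 0 ≤ c) : 0 ≤ (c : ℂ) • P :=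
  (ContinuousLinearMap.nonneg_iff_isPositive _).2
    (((ContinuousLinearMap.nonneg_iff_isPositive P).1 hP).smul_of_nonneg
      (Complex.zero_le_real.2 hc))

theorem convexCombination_mem_densityMatrices {H : Type*} [NormedAddCommGroup H]
    [InnerProductSpace ℂ H] [CompleteSpace H] {ρ σ : H →L[ℂ] H} (hρ : ρ ∈ densityMatrices H)
    (hσ : σ ∈ densityMatrices H) {a b : ℝ} (ha : 0 ≤ a) (hb : 0 ≤ b) (hab : a + b = 1) :
    (a : ℂ) • ρ + (b : ℂ) • σ ∈ densityMatrices H := by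
  rw [mem_densityMatrices_iff] at *
  have h1 := ofReal_smul_nonneg hρ.1 ha
  have h2 := ofReal_smul_nonneg hσ.1 hb
  refine ⟨add_nonneg h1 h2, ?_⟩
  rw [traceNorm_add_of_nonneg h1 h2, traceNorm_smul, traceNorm_smul, hρ.2, hσ.2, mul_one, mul_one,
    abs_of_nonneg ha, abs_of_nonneg hb, ← ENNReal.ofReal_add ha hb, hab, ENNReal.ofReal_one]

theorem traceNorm_sub_convexCombination_le {H : Type*} [NormedAddCommGroup H]
    [InnerProductSpace ℂ H] [CompleteSpace H] {ρ σ : H →L[ℂ] H} (hρ : ρ ∈ densityMatrices H)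
    (hσ : σ ∈ densityMatrices H) {a b : ℝ} (hb : 0 ≤ b) (hab : a + b = 1) :
    traceNorm (ρ - ((a : ℂ) • ρ + (b : ℂ) • σ)) ≤ ENNReal.ofReal (2 * b) := by
  rw [mem_densityMatrices_iff] at *
  have h : ρ - ((a : ℂ) • ρ + (b : ℂ) • σ) = (b : ℂ) • (ρ - σ) := by
    have : (a : ℂ) = 1 - b := by rw [← Complex.ofReal_one, ← hab]; push_cast; ring
    rw [this]; module
  rw [h, traceNorm_smul, abs_of_nonneg hb, mul_comm 2, ENNReal.ofReal_mul hb, ENNReal.ofReal_ofNat]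
  gcongr
  refine (traceNorm_sub_le hρ.1 hσ.1).trans_eq ?_
  rw [hρ.2, hσ.2]; norm_num

/-- By the Riemann–Lebesgue lemma on a vertical line, a Wigner function takes arbitrarily small
values. -/
theorem IsWignerFunction.exists_abs_lt {ρ : L2R →L[ℂ] L2R} {W : ℝ × ℝ → ℝ}
    (hW : IsWignerFunction ρ W) {η : ℝ} (hη : 0 < η) : ∃ z, |W z| < η := by
  obtain ⟨-, K, -, hK⟩ := hW
  obtain ⟨x, -, hx⟩ := hK.exists
  have h := Real.tendsto_integral_exp_smul_cocompact fun y : ℝ => K (x + y / 2, x - y / 2)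
  obtain ⟨w, hw⟩ := (h.eventually (Metric.ball_mem_nhds 0 hη)).exists
  rw [dist_zero_right] at hw
  refine ⟨(x, 2 * Real.pi * w), ?_⟩
  have h1 : (∫ v : ℝ, Real.fourierChar (-(v * w)) • K (x + v / 2, x - v / 2)) =
      ∫ y : ℝ, Complex.exp (-(Complex.I * ((2 * Real.pi * w : ℝ) : ℂ) * (y : ℂ))) *
        K (x + y / 2, x - y / 2) := by
    congr 1; ext y
    rw [Circle.smul_def, Real.fourierChar_apply, smul_eq_mul]
    congr 2
    push_cast; ring
  rw [h1] at hw
  have hpi : (1 : ℝ) ≤ 2 * Real.pi := by linarith [Real.pi_gt_three]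
  rw [← Real.norm_eq_abs, ← Complex.norm_real, hx, norm_mul]
  refine lt_of_le_of_lt (mul_le_of_le_one_left (norm_nonneg _) ?_) hw
  rw [norm_div, norm_one, show (2 * (Real.pi : ℂ)) = ((2 * Real.pi : ℝ) : ℂ) by push_cast; rfl,
    Complex.norm_real, Real.norm_of_nonneg (by linarith)]
  exact (div_le_one (by linarith)).2 hpi

theorem excitedWigner_self (x₀ ξ₀ : ℝ) : excitedWigner x₀ ξ₀ (x₀, ξ₀) = -(1 / Real.pi) := by
  simp [excitedWigner]

/-- The ball is that of the maximum norm on `ℝ × ℝ`, a square which contains the disc of radius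
`1 / √2` where the function is negative. -/
theorem excitedWigner_nonneg {x₀ ξ₀ : ℝ} {z : ℝ × ℝ}
    (hz : z ∉ Metric.closedBall (x₀, ξ₀) 1) : 0 ≤ excitedWigner x₀ ξ₀ z := by
  rw [Metric.mem_closedBall, Prod.dist_eq, max_le_iff, not_and_or, not_le, not_le,
    Real.dist_eq, Real.dist_eq] at hz
  have h : 1 ≤ (z.1 - x₀) ^ 2 + (z.2 - ξ₀) ^ 2 := by
    rcases hz with h | h
    · have := (one_lt_sq_iff_one_lt_abs _).2 h
      nlinarith [sq_nonneg (z.2 - ξ₀)]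
    · have := (one_lt_sq_iff_one_lt_abs _).2 h
      nlinarith [sq_nonneg (z.1 - x₀)]
  unfold excitedWigner
  refine mul_nonneg (mul_nonneg (by positivity) (by linarith)) (Real.exp_nonneg _)

/-- The largest multiple of the excited Wigner function which can be added to a positive function
`W` without destroying nonnegativity produces a zero; it is small where `W` is. -/
theorem exists_add_mul_excitedWigner {W : ℝ × ℝ → ℝ} (hc : Continuous W) (hpos : ∀ z, 0 < W z)
    (x₀ ξ₀ : ℝ) :
    ∃ s : ℝ, 0 < s ∧ s ≤ Real.pi * W (x₀, ξ₀) ∧ (∀ z, 0 ≤ W z + s * excitedWigner x₀ ξ₀ z) ∧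
      ∃ z, W z + s * excitedWigner x₀ ξ₀ z = 0 := by
  have hgc : Continuous fun z => -excitedWigner x₀ ξ₀ z / W z :=
    (continuous_excitedWigner x₀ ξ₀).neg.div hc fun z => (hpos z).ne'
  obtain ⟨w, -, hw⟩ := (isCompact_closedBall ((x₀, ξ₀) : ℝ × ℝ) 1).exists_isMaxOn
    ⟨_, Metric.mem_closedBall_self zero_le_one⟩ hgc.continuousOn
  set M := -excitedWigner x₀ ξ₀ w / W w with hM
  have h0 : 1 / Real.pi / W (x₀, ξ₀) ≤ M := by
    have := hw (Metric.mem_closedBall_self zero_le_one)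
    simpa [excitedWigner_self] using this
  have hW0 := hpos (x₀, ξ₀)
  have hM0 : 0 < M := lt_of_lt_of_le (by positivity) h0
  refine ⟨1 / M, by positivity, ?_, fun z => ?_, w, ?_⟩
  · rw [div_le_iff₀ hM0]
    rw [div_div, div_le_iff₀ (by positivity)] at h0
    linarith
  · by_cases hz : z ∈ Metric.closedBall (x₀, ξ₀) 1
    · have h1 : -excitedWigner x₀ ξ₀ z / W z ≤ M := hw hz
      rw [div_le_iff₀ (hpos z)] at h1
      have h2 : W z + 1 / M * excitedWigner x₀ ξ₀ z =
          (M * W z + excitedWigner x₀ ξ₀ z) / M := by field_simp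
      rw [h2]
      exact div_nonneg (by linarith) hM0.le
    · have := excitedWigner_nonneg hz
      have := hpos z
      positivity
  · have h1 : excitedWigner x₀ ξ₀ w = -(M * W w) := by
      rw [hM, div_mul_cancel₀ _ (hpos w).ne', neg_neg]
    rw [h1]
    field_simp
    ring

theorem wignerPositiveStates_subset_traceClosure :
    wignerPositiveStates ⊆ traceClosure vanishingWignerPositiveStates := by
  rintro ρ hρ
  refine ⟨hρ.1.1, fun ε hε => ?_⟩
  obtain ⟨hD, W, hW, hW0⟩ := hρ
  by_cases hz : (nodalSet W).Nonempty
  · exact ⟨ρ, ⟨⟨hD, W, hW, hW0⟩, W, hW, hz⟩, by rwa [sub_self, traceNorm_zero]⟩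
  have hpos (z) : 0 < W z := (hW0 z).lt_of_ne fun h => hz ⟨z, h.symm⟩
  obtain ⟨e, he, heε⟩ := ENNReal.lt_iff_exists_nnreal_btwn.1 hε
  have he0 : (0 : ℝ) < e := by exact_mod_cast he
  obtain ⟨⟨x₀, ξ₀⟩, hsmall⟩ := hW.exists_abs_lt (η := e / (2 * Real.pi)) (by positivity)
  obtain ⟨s, hs0, hs, hnonneg, z, hzero⟩ := exists_add_mul_excitedWigner hW.1 hpos x₀ ξ₀
  have hse : 2 * s ≤ e := by
    have h1 := (le_abs_self _).trans_lt hsmall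
    rw [lt_div_iff₀ (by positivity)] at h1
    linarith
  have hab : 1 / (1 + s) + s / (1 + s) = 1 := by field_simp
  have hσ := excitedProjection_mem_densityMatrices x₀ ξ₀
  have hV := hW.linearCombination (isWignerFunction_excitedProjection x₀ ξ₀)
    (1 / (1 + s)) (s / (1 + s))
  have hVeq (w) : 1 / (1 + s) * W w + s / (1 + s) * excitedWigner x₀ ξ₀ w =
      (W w + s * excitedWigner x₀ ξ₀ w) / (1 + s) := by field_simp
  refine ⟨_, ⟨⟨convexCombination_mem_densityMatrices hD hσ (by positivity) (by positivity) hab,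
    _, hV, fun w => ?_⟩, _, hV, z, ?_⟩,
    (traceNorm_sub_convexCombination_le hD hσ (by positivity) hab).trans_lt (lt_of_le_of_lt ?_ heε)⟩
  · rw [hVeq]
    exact div_nonneg (hnonneg w) (by positivity)
  · rw [nodalSet, Set.mem_ofPred_eq, hVeq, hzero, zero_div]
  · rw [← ENNReal.ofReal_coe_nnreal]
    refine ENNReal.ofReal_le_ofReal (le_trans ?_ hse)
    have : s / (1 + s) ≤ s := div_le_self hs0.le (by linarith)
    linarith

end Density

end

end WignerPositive

theorem theoremX :
    WignerPositive.wignerPositiveStates =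
      WignerPositive.traceClosure WignerPositive.vanishingWignerPositiveStates := by
  refine Set.Subset.antisymm WignerPositive.wignerPositiveStates_subset_traceClosure ?_
  rintro A ⟨hA, hlim⟩
  exact WignerPositive.wignerPositiveStates_closed ⟨hA, fun ε hε =>
    let ⟨B, hB, h⟩ := hlim ε hε
    ⟨B, hB.1, h⟩⟩
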